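/- A \emph{Conway algebra} is a set $A$ with elements $a_1,a_2,\dots\in A$ and two binary operations $|$ and $\ast$ such that, for all $n\ge 1$ and all $a,b,c,d\in A$: $a_n|a_{n+1}=a_n$; $a_n\ast a_{n+1}=a_n$; $(a|b)|(c|d)=(a|c)|(b|d)$; $(a|b)\ast(c|d)=(a\ast c)|(b\ast d)$; $(a\ast b)\ast(c\ast d)=(a\ast c)\ast(b\ast d)$; $(a|b)\ast b=a$; $(a\ast b)|b=a$. An \emph{invariant yielded by} the algebra assigns to each oriented link $L$ an element $w_L\in A$, depending only on the isotopy class of $L$ (that is, on a diagram of $L$ up to Reidemeister moves), such that $w_{T_n}=a_n$ for the trivial link $T_n$ with $n\geq 1$ components, and $w_{L_+}=w_{L_-}|w_{L_0}$ and $w_{L_-}=w_{L_+}\ast w_{L_0}$ whenever $L_+,L_-,L_0$ have diagrams that are identical except near one crossing, which is positive in $L_+$, negative in $L_-$ and smoothed along the orientation in $L_0$. Let $B_3=\langle\sigma_1,\sigma_2\mid\sigma_1\sigma_2\sigma_1=\sigma_2\sigma_1\sigma_2\rangle$ be the braid group on three strings, with $\sigma_1,\sigma_2$ represented by positive crossings,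 let $\Delta=\sigma_1\sigma_2\sigma_1$, and write $\hat\beta$ for the oriented link that is the closure of $\beta\in B_3$. \textbf{Theorem.} Let $k\ge 0$, let $a_1,\dots,a_{2k}$ and $r$ be integers with $\sum_{i=1}^{2k}a_i=6r$, let $\gamma=\sigma_1^{a_1}\sigma_2^{a_2}\cdots\sigma_1^{a_{2k-1}}\sigma_2^{a_{2k}}\in B_3$ and let $\mathcal B=\Delta^{4r}\gamma^{-1}$. Then $w_{\hat\gamma}=w_{\hat{\mathcal B}}$ for every invariant $w$ yielded by a Conway algebra. -/

import Mathlib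

/-- A Conway algebra `(A; a₁, a₂, …, |, ∗)`; `bar x y` is `x | y` and `star x y` is `x ∗ y`. -/
structure ConwayAlgebra (A : Type*) where
  a : ℕ+ → A
  bar : A → A → A
  star : A → A → A
  c1 : ∀ n, bar (a n) (a (n + 1)) = a n
  c2 : ∀ n, star (a n) (a (n + 1)) = a n
  c3 : ∀ x y z t, bar (bar x y) (bar z t) = bar (bar x z) (bar y t)
  c4 : ∀ x y z t, star (bar x y) (bar z t) = bar (star x z) (star y t)
  c5 : ∀ x y z t, star (star x y) (star z t) = star (star x z) (star y t)
  c6 : ∀ x y, star (bar x y) y = x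
  c7 : ∀ x y, bar (star x y) y = x

/-! ### Oriented link diagrams

A diagram is recorded by a finite set `P` of points marked on the link, containing the two
preimages of every crossing and possibly further points, such that every component carries a
marked point. The permutation `next` sends a marked point to the following one along the
orientation, so that its cycles are the components and each `p` names the arc from `p` to
`next p`. -/

/-- A crossing, drawn with both strands running upwards: the strand through `left` runs from the
bottom left to the top right, the strand through `right` from the bottom right to the top left.
The strand through `left` is the upper one exactly if the crossing is positive. -/
structure Crossing (P : Type) where
  left : P
  right : P
  sign : ℤˣ

namespace Crossing

variable {P Q : Type}

def upper (c : Crossing P) : P := if c.sign = 1 then c.left else c.right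

def lower (c : Crossing P) : P := if c.sign = 1 then c.right else c.left

/-- The crossing of sign `s` with upper point `o` and lower point `u`. -/
def ofUpperLower (o u : P) (s : ℤˣ) : Crossing P := if s = 1 then ⟨o, u, s⟩ else ⟨u, o, s⟩

/-- The crossing change. -/
def flip (c : Crossing P) : Crossing P := ⟨c.left, c.right, -c.sign⟩

def map (f : P → Q) (c : Crossing P) : Crossing Q := ⟨f c.left, f c.right, c.sign⟩

def Meets (c : Crossing P) (p : P) : Prop := p = c.left ∨ p = c.right

end Crossing

/-- The combinatorial data of an oriented link diagram (drawn on some closed oriented surface;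
see `Diagram.Planar`). -/
structure Diagram (P : Type) where
  next : Equiv.Perm P
  crossings : Set (Crossing P)
  left_ne_right : ∀ c ∈ crossings, c.left ≠ c.right
  eq_of_meets : ∀ c ∈ crossings, ∀ d ∈ crossings, ∀ p, c.Meets p → d.Meets p → c = d

namespace Diagram

variable {P : Type}

/-- The two sides of the arc that starts at `p` are `(p, true)` (left of the arc) and
`(p, false)` (right of it). `D.Corner s s'` says that `s` and `s'` bound the same corner at a
marked point: a crossing has a left, a right, a top and a bottom corner, and at a point that is
not on a crossing the two sides just continue. -/
inductive Corner (D : Diagram P) : P × Bool → P × Bool → Prop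
  | left (c) (hc : c ∈ D.crossings) : Corner D (D.next.symm c.left, true) (c.right, true)
  | right (c) (hc : c ∈ D.crossings) : Corner D (D.next.symm c.right, false) (c.left, false)
  | top (c) (hc : c ∈ D.crossings) : Corner D (c.right, false) (c.left, true)
  | bottom (c) (hc : c ∈ D.crossings) :
      Corner D (D.next.symm c.left, false) (D.next.symm c.right, true)
  | pass (p) (hp : ∀ c ∈ D.crossings, ¬ c.Meets p) (b) : Corner D (D.next.symm p, b) (p, b)

/-- The boundary circles of a ribbon neighbourhood of the projection, that is, the faces of the
surface obtained by gluing discs to them. -/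
def Face (D : Diagram P) : Type := Quot D.Corner

/-- Two marked points are linked if they follow each other or lie on the same crossing. -/
inductive Linked (D : Diagram P) : P → P → Prop
  | next (p) : Linked D p (D.next p)
  | cross (c) (hc : c ∈ D.crossings) : Linked D c.left c.right

/-- The connected components of the projection. -/
def Piece (D : Diagram P) : Type := Quot D.Linked

/-- The diagram is drawn on the sphere (equivalently, in the plane): every piece has Euler
characteristic `2`. There are `|P| - #crossings` vertices and `|P|` arcs, so the total Euler
characteristic is `#faces - #crossings`; each piece contributes at most `2` to it. -/
def Planar (D : Diagram P) : Prop :=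
  Nat.card D.Face = Nat.card D.crossings + 2 * Nat.card D.Piece

/-- `q` is the neighbour of `p` in the direction `ε`: after `p` for `ε = 1`, before it for
`ε = -1`. -/
def Step (D : Diagram P) (ε : ℤˣ) (p q : P) : Prop :=
  (ε = 1 ∧ D.next p = q) ∨ (ε = -1 ∧ D.next q = p)

/-- The elementary moves on diagrams: renaming the marked points, marking one more point, and the
Reidemeister moves with all choices of orientations and signs. For the first and the second
Reidemeister move, the direction that removes crossings is given. -/
inductive Move : {P Q : Type} → Diagram P → Diagram Q → Prop
  | relabel {P Q : Type} (D : Diagram P) (D' : Diagram Q) (e : P ≃ Q)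
      (hnext : ∀ p, D'.next (e p) = e (D.next p))
      (hcross : D'.crossings = Crossing.map e '' D.crossings) : Move D D'
  | mark {P : Type} (D : Diagram P) (D' : Diagram (Option P)) (p : P)
      (hp : D'.next (some p) = none) (hnone : D'.next none = some (D.next p))
      (hnext : ∀ q, q ≠ p → D'.next (some q) = some (D.next q))
      (hcross : D'.crossings = Crossing.map some '' D.crossings) : Move D D'
  | reidemeister1 {P : Type} (D D' : Diagram P) (c : Crossing P) (hc : c ∈ D.crossings)
      (hloop : D.next c.left = c.right ∨ D.next c.right = c.left)
      (hnext : D'.next = D.next) (hcross : D'.crossings = D.crossings \ {c}) : Move D D'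
  | reidemeister2 {P : Type} (D D' : Diagram P) (c d : Crossing P)
      (hc : c ∈ D.crossings) (hd : d ∈ D.crossings) (hsign : d.sign = -c.sign)
      (hupper : D.next c.upper = d.upper)
      (hlower : D.next c.lower = d.lower ∨ D.next d.lower = c.lower)
      (hnext : D'.next = D.next) (hcross : D'.crossings = D.crossings \ {c, d}) : Move D D'
  /-- Crossings `c` (top over middle strand), `d` (top over bottom), `e` (middle over bottom),
  neighbouring on each of the three strands. The condition on the signs says that the three
  connecting arcs bound a triangular face: reversing a strand changes the sign of its two crossings
  and the direction in which it runs through them, and if the three directions are `1` then the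
  strands form the positive or the negative half twist, with three equal signs. The move exchanges
  the two crossings on each strand. -/
  | reidemeister3 {P : Type} (D D' : Diagram P) (c d e : Crossing P)
      (hc : c ∈ D.crossings) (hd : d ∈ D.crossings) (he : e ∈ D.crossings)
      (hcd : c ≠ d) (hce : c ≠ e) (hde : d ≠ e) (εt εm εb : ℤˣ)
      (htop : D.Step εt c.upper d.upper) (hmiddle : D.Step εm c.lower e.upper)
      (hbottom : D.Step εb d.lower e.lower)
      (hsign₁ : c.sign * (εt * εm) = d.sign * (εt * εb))
      (hsign₂ : d.sign * (εt * εb) = e.sign * (εm * εb))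
      (hnext : D'.next = D.next)
      (hcross : D'.crossings = (D.crossings \ {c, d, e}) ∪
        {Crossing.ofUpperLower d.upper e.upper c.sign,
         Crossing.ofUpperLower c.upper e.lower d.sign,
         Crossing.ofUpperLower c.lower d.lower e.sign}) : Move D D'

/-- The crossing-free diagram with `n` components. -/
def trivialLink (n : ℕ) : Diagram (Fin n) where
  next := 1
  crossings := ∅
  left_ne_right := fun _ hc => hc.elim
  eq_of_meets := fun _ hc => hc.elim

/-- `L₊`, `L₋`, `L₀` are identical except at one crossing, which is positive in `L₊`, negative in
`L₋`, and smoothed along the orientation in `L₀`: each strand that enters the crossing leaves it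
along the other one. -/
def SkeinTriple (Lp Lm L0 : Diagram P) : Prop :=
  ∃ c ∈ Lp.crossings, c.sign = 1 ∧
    Lm.next = Lp.next ∧ Lm.crossings = insert c.flip (Lp.crossings \ {c}) ∧
    L0.next c.left = Lp.next c.right ∧ L0.next c.right = Lp.next c.left ∧
    (∀ p, ¬ c.Meets p → L0.next p = Lp.next p) ∧
    L0.crossings = Lp.crossings \ {c}

end Diagram

/-- `w` is the invariant of oriented links yielded by the Conway algebra `𝒜`. Only its values on
planar diagrams matter. -/
structure ConwayAlgebra.IsLinkInvariant {A : Type*} (𝒜 : ConwayAlgebra A)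
    (w : ∀ {P : Type}, Diagram P → A) : Prop where
  isotopy : ∀ {P Q : Type} [Finite P] [Finite Q] (D : Diagram P) (D' : Diagram Q),
    D.Planar → D'.Planar → D.Move D' → w D = w D'
  initial : ∀ n : ℕ+, w (Diagram.trivialLink n) = 𝒜.a n
  conway_pos : ∀ {P : Type} [Finite P] (Lp Lm L0 : Diagram P),
    Lp.Planar → Lm.Planar → L0.Planar → Diagram.SkeinTriple Lp Lm L0 →
      w Lp = 𝒜.bar (w Lm) (w L0)
  conway_neg : ∀ {P : Type} [Finite P] (Lp Lm L0 : Diagram P),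
    Lp.Planar → Lm.Planar → L0.Planar → Diagram.SkeinTriple Lp Lm L0 →
      w Lm = 𝒜.star (w Lp) (w L0)

/-! ### Braids on three strings -/

/-- Artin's relation between `σ₁` (index `0`) and `σ₂` (index `1`). -/
def braidThreeRels : Set (FreeGroup (Fin 2)) :=
  {FreeGroup.of 0 * FreeGroup.of 1 * FreeGroup.of 0 *
    (FreeGroup.of 1 * FreeGroup.of 0 * FreeGroup.of 1)⁻¹}

abbrev BraidThree : Type := PresentedGroup braidThreeRels

namespace BraidThree

def sigma (i : Fin 2) : BraidThree := PresentedGroup.of i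

def Delta : BraidThree := sigma 0 * sigma 1 * sigma 0

/-- A braid word: `(i, true)` stands for `σᵢ₊₁` and `(i, false)` for its inverse. -/
abbrev Word : Type := List (Fin 2 × Bool)

def Word.toBraid (u : Word) : BraidThree := PresentedGroup.mk braidThreeRels (FreeGroup.mk u)

/-- The diagram of the closed braid of a word. Marked are the points `(t, j)`, where the string in
position `j` (counted from the left) passes level `t`; the letter number `t` is the crossing at
level `t`, the last level has no crossing, and it is followed by level `0`. -/
def Word.closure (u : Word) : Diagram (Fin (u.length + 1) × Fin 3) where
  next := Equiv.prodShear (finRotate (u.length + 1)) fun t =>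
    match u[(t : ℕ)]? with
    | some l => Equiv.swap l.1.castSucc l.1.succ
    | none => 1
  crossings := {c | ∃ (t : Fin (u.length + 1)) (l : Fin 2 × Bool), u[(t : ℕ)]? = some l ∧
    c = ⟨(t, l.1.castSucc), (t, l.1.succ), if l.2 then 1 else -1⟩}
  left_ne_right := by
    rintro _ ⟨t, l, -, rfl⟩ h
    exact (Fin.castSucc_lt_succ (i := l.1)).ne (Prod.ext_iff.1 h).2
  eq_of_meets := by
    rintro _ ⟨t, l, hl, rfl⟩ _ ⟨t', l', hl', rfl⟩ p hp hp'
    have h1 : p.1 = t := by rcases hp with rfl | rfl <;> rfl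
    have h2 : p.1 = t' := by rcases hp' with rfl | rfl <;> rfl
    have ht : t = t' := h1.symm.trans h2
    subst ht
    have hll : l = l' := Option.some.inj (hl.symm.trans hl')
    rw [hll]

end BraidThree

/-! Let `W z` be the value of `w` on the closure of a braid `z` on three strings. It is constant on
conjugacy classes and satisfies `W (σᵢ x) = W (σᵢ⁻¹ x) | W x` (`braidValue_mul_comm`,
`braidValue_skein`). These two facts suffice to show `W z = W z*`, with `z* = Δ^(4r) z⁻¹`, for every
`z` of exponent sum `6r` (`eq_dual_of_expo_eq`).

Linearization. Let `R_y` be the permutation `x ↦ x | y`. The law `c3` forces all quotients `R_x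
R_y⁻¹` to commute, and `n x = R_x R_o⁻¹` maps `A` to a module over a commutative ring where `n (x |
y) = s n x + b n y + c` (`exists_linearization`). The map `n` need not be injective, but `n x - n y`
determines `R_x R_y⁻¹`. The function `f = n ∘ W` is thus an affine trace for the Hecke relation `σ²
= s + b σ`.

Hecke algebra. For such a trace `z + z*` behaves like a central element (`trace_add_dual_commute`).
On differences of braids of equal exponent sum, which the one-dimensional representations do not
see, `Δ²` acts as `s³` (`trace_Delta_sq`). In the two-dimensional representation `det σᵢ = -s`, so
`z + (-s)^e z⁻¹` is a scalar by Cayley–Hamilton, where `e` is the exponent sum of `z`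
(`add_neg_zpow_smul_inv_eq_zero`). For `e = 6r` the factors match. Consequently `f (σᵢ⁻¹ z) + f
(σᵢ⁻¹ z*)` depends neither on `i` nor on the choice of `z` in its conjugacy class.

Exchange. Passing from `x σᵢ y σⱼ⁻¹` to `x σᵢ⁻¹ y σⱼ` changes `W` by a quotient `R_p R_q⁻¹`, and by
the previous identity the values on the duals change by the same quotient. So one braid satisfies `W
z = W z*` exactly if the other does (`selfDual_exchange`). For this question `σ₁²` and `σ₂²` are
therefore equal and central, and only permutation braids times powers of `σ₁²` remain. The exponent
sum leaves the representatives `Δ^(2r)`, its own dual, and `σᵢ σⱼ⁻¹ Δ^(2r)` with `i ≠ j`, conjugate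
by `Δ` to its dual.

It remains to see that `W` is well defined on the braid group. Closed braid diagrams are planar by a
count of faces and pieces (`planar_level`), free cancellation is a second Reidemeister move
(`move_cancel`), and Artin's relation is a third one (`move_halfTwist`), up to marking and renaming
points. -/

namespace ConwayAlgebra

-- Translations of a Conway algebra and its linearization

universe u

variable {A : Type u} (𝒜 : ConwayAlgebra A)

/-- The permutation `x ↦ x | y`, with inverse `x ↦ x ∗ y`. -/
def barPerm (y : A) : Equiv.Perm A where
  toFun x := 𝒜.bar x y
  invFun x := 𝒜.star x y
  left_inv x := 𝒜.c6 x y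
  right_inv x := 𝒜.c7 x y

theorem barPerm_apply (x y : A) : 𝒜.barPerm y x = 𝒜.bar x y := rfl

theorem barPerm_inv_apply (x y : A) : (𝒜.barPerm y)⁻¹ x = 𝒜.star x y := rfl

theorem barPerm_bar_mul (y z t : A) :
    𝒜.barPerm (𝒜.bar z t) * 𝒜.barPerm y = 𝒜.barPerm (𝒜.bar y t) * 𝒜.barPerm z :=
  Equiv.ext fun x => 𝒜.c3 x y z t

theorem barPerm_mul_inv_eq (y z t : A) :
    𝒜.barPerm z * (𝒜.barPerm y)⁻¹ =
      (𝒜.barPerm (𝒜.bar y t))⁻¹ * 𝒜.barPerm (𝒜.bar z t) := by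
  rw [eq_inv_mul_iff_mul_eq, ← mul_assoc, ← 𝒜.barPerm_bar_mul, mul_inv_cancel_right]

/-- Write `y = y' | o`, `z = z' | o` and `o = p | o`. Instances of `barPerm_mul_inv_eq` give `R_z'
R_y'⁻¹` both as `R_y⁻¹ R_z` and, eliminating `R_p`, as `R_o⁻¹ R_z R_y⁻¹ R_o`. Their equality is the
commutation. -/
theorem commute_barPerm_mul_inv_same (y z o : A) :
    Commute (𝒜.barPerm y * (𝒜.barPerm o)⁻¹) (𝒜.barPerm z * (𝒜.barPerm o)⁻¹) := by
  obtain ⟨y, rfl⟩ : ∃ y', 𝒜.bar y' o = y := ⟨𝒜.star y o, 𝒜.c7 y o⟩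
  obtain ⟨z, rfl⟩ : ∃ z', 𝒜.bar z' o = z := ⟨𝒜.star z o, 𝒜.c7 z o⟩
  obtain ⟨p, hp⟩ : ∃ p, 𝒜.bar p o = o := ⟨𝒜.star o o, 𝒜.c7 o o⟩
  have h1 := 𝒜.barPerm_mul_inv_eq p z o
  have h2 := 𝒜.barPerm_mul_inv_eq p y o
  have h3 := 𝒜.barPerm_mul_inv_eq y z o
  rw [hp] at h1 h2
  have h4 : 𝒜.barPerm z * (𝒜.barPerm y)⁻¹ =
      ((𝒜.barPerm o)⁻¹ * 𝒜.barPerm (𝒜.bar z o)) *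
        ((𝒜.barPerm o)⁻¹ * 𝒜.barPerm (𝒜.bar y o))⁻¹ := by
    rw [← h1, ← h2]; group
  rw [h3] at h4
  generalize 𝒜.barPerm (𝒜.bar y o) = Y at *
  generalize 𝒜.barPerm (𝒜.bar z o) = Z at *
  generalize 𝒜.barPerm o = O at *
  have h5 : Y * O⁻¹ * (O * (Y⁻¹ * Z) * O⁻¹) * (Y * O⁻¹)  =
      Y * O⁻¹ * (O * (O⁻¹ * Z * (O⁻¹ * Y)⁻¹) * O⁻¹) * (Y * O⁻¹) := by rw [h4]
  have h6 : Y * O⁻¹ * (O * (Y⁻¹ * Z) * O⁻¹) * (Y * O⁻¹) = Z * O⁻¹ * (Y * O⁻¹) := by group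
  have h7 : Y * O⁻¹ * (O * (O⁻¹ * Z * (O⁻¹ * Y)⁻¹) * O⁻¹) * (Y * O⁻¹) =
    Y * O⁻¹ * (Z * O⁻¹) := by group
  exact (h6.symm.trans (h5.trans h7)).symm

theorem commute_barPerm_mul_inv (x y z t : A) :
    Commute (𝒜.barPerm x * (𝒜.barPerm y)⁻¹) (𝒜.barPerm z * (𝒜.barPerm t)⁻¹) := by
  have key : ∀ u v, 𝒜.barPerm u * (𝒜.barPerm v)⁻¹ =
      (𝒜.barPerm u * (𝒜.barPerm x)⁻¹) * (𝒜.barPerm v * (𝒜.barPerm x)⁻¹)⁻¹ := by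
    intro u v; group
  rw [key x y, key z t]
  have h := fun u v => 𝒜.commute_barPerm_mul_inv_same u v x
  exact ((h _ _).mul_left (h _ _).inv_left).mul_right ((h _ _).mul_left (h _ _).inv_left).inv_right

/-- Conjugating `barPerm_mul_inv_eq` by the permutation of `y | t` gives the left side. Any other
`o` conjugates in the same way, because the two permutations differ by a quotient and quotients
commute. -/
theorem barPerm_bar_mul_inv (o y z t : A) :
    𝒜.barPerm (𝒜.bar z t) * (𝒜.barPerm (𝒜.bar y t))⁻¹ =
      𝒜.barPerm o * (𝒜.barPerm z * (𝒜.barPerm y)⁻¹) * (𝒜.barPerm o)⁻¹ := by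
  have h1 := 𝒜.barPerm_mul_inv_eq y z t
  have h2 := (𝒜.commute_barPerm_mul_inv o (𝒜.bar y t) (𝒜.bar z t) (𝒜.bar y t)).eq
  rw [h1]
  generalize 𝒜.barPerm (𝒜.bar y t) = Y at *
  generalize 𝒜.barPerm (𝒜.bar z t) = Z at *
  generalize 𝒜.barPerm o = O at *
  have h3 : O * (Y⁻¹ * Z) * O⁻¹ = (O * Y⁻¹ * (Z * Y⁻¹)) * Y * O⁻¹ := by group
  rw [h3, h2]
  group

theorem barPerm_bar_mul_inv_left (x y t t' : A) :
    𝒜.barPerm (𝒜.bar x t) * (𝒜.barPerm (𝒜.bar x t'))⁻¹ =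
      𝒜.barPerm (𝒜.bar y t) * (𝒜.barPerm (𝒜.bar y t'))⁻¹ := by
  have h1 := (𝒜.barPerm_bar_mul_inv x y x t).trans (𝒜.barPerm_bar_mul_inv x y x t').symm
  have h2 := (𝒜.commute_barPerm_mul_inv (𝒜.bar x t') (𝒜.bar y t')
    (𝒜.bar y t) (𝒜.bar y t')).eq
  generalize 𝒜.barPerm (𝒜.bar y t) = a at *
  generalize 𝒜.barPerm (𝒜.bar y t') = b at *
  generalize 𝒜.barPerm (𝒜.bar x t) = c at *
  generalize 𝒜.barPerm (𝒜.bar x t') = d at *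
  have h3 : c * d⁻¹ = c * a⁻¹ * (a * b⁻¹) * (d * b⁻¹)⁻¹ := by group
  rw [h3, h1, h2, mul_inv_cancel_right]

/-- The group generated by the quotients of the permutations `x ↦ x | y`. -/
def translations : Subgroup (Equiv.Perm A) :=
  Subgroup.closure (Set.range fun p : A × A => 𝒜.barPerm p.1 * (𝒜.barPerm p.2)⁻¹)

theorem barPerm_mul_inv_mem (x y : A) : 𝒜.barPerm x * (𝒜.barPerm y)⁻¹ ∈ 𝒜.translations :=
  Subgroup.subset_closure ⟨(x, y), rfl⟩

theorem isMulCommutative_translations : IsMulCommutative 𝒜.translations :=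
  Subgroup.isMulCommutative_closure (by
    rintro _ ⟨p, rfl⟩ _ ⟨q, rfl⟩
    exact 𝒜.commute_barPerm_mul_inv _ _ _ _)

theorem conj_mem_translations (o : A) {g : Equiv.Perm A} (hg : g ∈ 𝒜.translations) :
    𝒜.barPerm o * g * (𝒜.barPerm o)⁻¹ ∈ 𝒜.translations := by
  induction hg using Subgroup.closure_induction with
  | mem x hx =>
    obtain ⟨p, rfl⟩ := hx
    rw [← 𝒜.barPerm_bar_mul_inv o p.2 p.1 o]
    exact 𝒜.barPerm_mul_inv_mem _ _
  | one => simp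
  | mul x y _ _ hx hy =>
    have := 𝒜.translations.mul_mem hx hy
    rwa [conj_mul] at this
  | inv x _ hx =>
    have := 𝒜.translations.inv_mem hx
    rwa [conj_inv] at this

theorem inv_conj_mem_translations (o : A) {g : Equiv.Perm A} (hg : g ∈ 𝒜.translations) :
    (𝒜.barPerm o)⁻¹ * g * 𝒜.barPerm o ∈ 𝒜.translations := by
  induction hg using Subgroup.closure_induction with
  | mem x hx =>
    obtain ⟨p, rfl⟩ := hx
    have h := 𝒜.barPerm_bar_mul_inv o (𝒜.star p.2 o) (𝒜.star p.1 o) o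
    rw [𝒜.c7, 𝒜.c7] at h
    simp only [h]
    have := 𝒜.barPerm_mul_inv_mem (𝒜.star p.1 o) (𝒜.star p.2 o)
    convert this using 1
    group
  | one => simp
  | mul x y _ _ hx hy =>
    have := 𝒜.translations.mul_mem hx hy
    convert this using 1
    group
  | inv x _ hx =>
    have := 𝒜.translations.inv_mem hx
    convert this using 1
    group

/-- A generator `R_a R_b⁻¹` takes `x = (x ∗ b) | b` to `(x ∗ b) | a`, so `barPerm_bar_mul_inv_left`
applies. Independence of the base point is what makes `shiftEnd` additive. -/
theorem barPerm_translation_mul_inv {g : Equiv.Perm A} (hg : g ∈ 𝒜.translations) (x y : A) :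
    𝒜.barPerm (g x) * (𝒜.barPerm x)⁻¹ = 𝒜.barPerm (g y) * (𝒜.barPerm y)⁻¹ := by
  induction hg using Subgroup.closure_induction generalizing x y with
  | mem g hg =>
    obtain ⟨⟨a, b⟩, rfl⟩ := hg
    have := 𝒜.barPerm_bar_mul_inv_left (𝒜.star x b) (𝒜.star y b) a b
    rwa [𝒜.c7, 𝒜.c7] at this
  | one => simp
  | mul g h _ _ hg hh =>
    have h1 := hg (h x) (h y)
    have h2 := hh x y
    have h3 : ∀ z, 𝒜.barPerm ((g * h) z) * (𝒜.barPerm z)⁻¹ =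
        (𝒜.barPerm (g (h z)) * (𝒜.barPerm (h z))⁻¹) *
        (𝒜.barPerm (h z) * (𝒜.barPerm z)⁻¹) := by
      intro z; rw [Equiv.Perm.mul_apply]; group
    rw [h3, h3, h1, h2]
  | inv g _ hg =>
    have h1 := congrArg (·⁻¹) (hg (g⁻¹ x) (g⁻¹ y))
    simpa using h1

/-- The group of translations, written additively. -/
def Translation : Type u := Additive 𝒜.translations

instance : AddCommGroup 𝒜.Translation := 
  { (inferInstance : AddGroup (Additive 𝒜.translations)) with
    add_comm := fun g h => 𝒜.isMulCommutative_translations.is_comm.comm g.toMul h.toMul }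

/-- The permutation underlying a translation. -/
def Translation.perm {𝒜 : ConwayAlgebra A} (g : 𝒜.Translation) : Equiv.Perm A :=
  (Additive.toMul (α := 𝒜.translations) g : 𝒜.translations)

/-- Conjugation by `x ↦ x | o`, as an endomorphism of the group of translations. -/
def conjEnd (o : A) : AddMonoid.End 𝒜.Translation :=
  AddMonoidHom.mk' (fun g => Additive.ofMul ⟨_, 𝒜.conj_mem_translations o g.toMul.2⟩)
    fun g h => Subtype.ext (conj_mul (a := g.perm) (b := 𝒜.barPerm o) (c := h.perm)).symm

def invConjEnd (o : A) : AddMonoid.End 𝒜.Translation :=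
  AddMonoidHom.mk' (fun g => Additive.ofMul ⟨_, 𝒜.inv_conj_mem_translations o g.toMul.2⟩)
    fun g h => Subtype.ext (by
      change (𝒜.barPerm o)⁻¹ * (g.perm * h.perm) * 𝒜.barPerm o =
        ((𝒜.barPerm o)⁻¹ * g.perm * 𝒜.barPerm o) * ((𝒜.barPerm o)⁻¹ * h.perm * 𝒜.barPerm o)
      group)

/-- The change of `x ↦ R_x R_o⁻¹` under a translation of `x`, where `R_x` is `y ↦ y | x`. -/
def shiftEnd (o : A) : AddMonoid.End 𝒜.Translation :=
  AddMonoidHom.mk' (fun g => Additive.ofMul ⟨_, 𝒜.barPerm_mul_inv_mem (g.perm o) o⟩)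
    fun g h => Subtype.ext (by
      change 𝒜.barPerm (g.perm (h.perm o)) * (𝒜.barPerm o)⁻¹ =
        (𝒜.barPerm (g.perm o) * (𝒜.barPerm o)⁻¹) * (𝒜.barPerm (h.perm o) * (𝒜.barPerm o)⁻¹)
      rw [𝒜.barPerm_translation_mul_inv (g := g.perm) g.toMul.2 o (h.perm o)]
      group)

theorem conjEnd_mul_invConjEnd (o : A) : 𝒜.conjEnd o * 𝒜.invConjEnd o = 1 := by
  refine AddMonoidHom.ext fun g => Subtype.ext ?_
  change 𝒜.barPerm o * ((𝒜.barPerm o)⁻¹ * g.perm * 𝒜.barPerm o) *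
    (𝒜.barPerm o)⁻¹ = g.perm
  group

theorem invConjEnd_mul_conjEnd (o : A) : 𝒜.invConjEnd o * 𝒜.conjEnd o = 1 := by
  refine AddMonoidHom.ext fun g => Subtype.ext ?_
  change (𝒜.barPerm o)⁻¹ * (𝒜.barPerm o * g.perm * (𝒜.barPerm o)⁻¹) *
    𝒜.barPerm o = g.perm
  group

/-- Evaluate the shift at the base point `o | o` instead of `o`: the conjugate of `g` takes it to `g
o | o`, and `barPerm_bar_mul_inv` recognizes the resulting quotient as a conjugate. -/
theorem commute_conjEnd_shiftEnd (o : A) : Commute (𝒜.conjEnd o) (𝒜.shiftEnd o) := by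
  refine AddMonoidHom.ext fun g => Subtype.ext ?_
  change 𝒜.barPerm o * (𝒜.barPerm (g.perm o) * (𝒜.barPerm o)⁻¹) *
    (𝒜.barPerm o)⁻¹ = 𝒜.barPerm
      ((𝒜.barPerm o * g.perm * (𝒜.barPerm o)⁻¹) o) * (𝒜.barPerm o)⁻¹
  rw [𝒜.barPerm_translation_mul_inv (g := 𝒜.barPerm o * g.perm * (𝒜.barPerm o)⁻¹)
    (𝒜.conj_mem_translations o g.toMul.2) o (𝒜.bar o o), ← 𝒜.barPerm_bar_mul_inv o o _ o]
  simp only [Equiv.Perm.mul_apply, barPerm_inv_apply, 𝒜.c6, barPerm_apply]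

/-- Every Conway algebra maps to a module over a commutative ring on which `x | y` is an affine
function, and the quotients of the permutations `x ↦ x | y` depend only on the differences of the
images of their indices. -/
theorem exists_linearization :
    ∃ (R N : Type u) (_ : CommRing R) (_ : AddCommGroup N) (_ : Module R N)
      (s : Rˣ) (b : R) (c : N) (n : A → N),
      (∀ x y, n (𝒜.bar x y) = s • n x + b • n y + c) ∧
      ∀ x y x' y', n x - n y = n x' - n y' →
        𝒜.barPerm x * (𝒜.barPerm y)⁻¹ = 𝒜.barPerm x' * (𝒜.barPerm y')⁻¹ := by
  -- Any base point would do; `a₁` witnesses that `A` is nonempty.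
  let o : A := 𝒜.a 1
  let E : Set (AddMonoid.End 𝒜.Translation) :=
    {𝒜.conjEnd o, 𝒜.invConjEnd o, 𝒜.shiftEnd o}
  have h1 : 𝒜.conjEnd o * 𝒜.invConjEnd o = 𝒜.invConjEnd o * 𝒜.conjEnd o := by
    rw [conjEnd_mul_invConjEnd, invConjEnd_mul_conjEnd]
  have h2 := (𝒜.commute_conjEnd_shiftEnd o).eq
  have h3 : 𝒜.invConjEnd o * 𝒜.shiftEnd o = 𝒜.shiftEnd o * 𝒜.invConjEnd o := by
    let U : (AddMonoid.End 𝒜.Translation)ˣ :=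
      ⟨_, _, 𝒜.conjEnd_mul_invConjEnd o, 𝒜.invConjEnd_mul_conjEnd o⟩
    have : Commute (U : AddMonoid.End _) (𝒜.shiftEnd o) := 𝒜.commute_conjEnd_shiftEnd o
    exact this.units_inv_left.eq
  have hE : ∀ x ∈ E, ∀ y ∈ E, x * y = y * x := by
    rintro x (rfl | rfl | rfl) y (rfl | rfl | rfl) <;>
      first | rfl | assumption | (symm; assumption)
  let _ : CommRing (Subring.closure E) :=
    { (inferInstance : Ring (Subring.closure E)) with
      mul_comm := (Subring.isMulCommutative_closure hE).is_comm.comm }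
  have m1 : 𝒜.conjEnd o ∈ Subring.closure E := Subring.subset_closure (by simp [E])
  have m2 : 𝒜.invConjEnd o ∈ Subring.closure E := Subring.subset_closure (by simp [E])
  have m3 : 𝒜.shiftEnd o ∈ Subring.closure E := Subring.subset_closure (by simp [E])
  let n : A → 𝒜.Translation := fun x =>
    Additive.ofMul ⟨_, 𝒜.barPerm_mul_inv_mem x o⟩
  refine ⟨Subring.closure E, 𝒜.Translation, inferInstance, inferInstance,
    (inferInstance : Module (Subring.closure E) 𝒜.Translation),
    ⟨⟨_, m1⟩, ⟨_, m2⟩, Subtype.ext (𝒜.conjEnd_mul_invConjEnd o),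
      Subtype.ext (𝒜.invConjEnd_mul_conjEnd o)⟩, ⟨_, m3⟩, n (𝒜.bar o o), n, ?_, ?_⟩
  · intro x y
    refine Subtype.ext ?_
    change 𝒜.barPerm (𝒜.bar x y) * (𝒜.barPerm o)⁻¹ =
      𝒜.barPerm o * (𝒜.barPerm x * (𝒜.barPerm o)⁻¹) * (𝒜.barPerm o)⁻¹ *
      (𝒜.barPerm ((𝒜.barPerm y * (𝒜.barPerm o)⁻¹) o) * (𝒜.barPerm o)⁻¹) *
      (𝒜.barPerm (𝒜.bar o o) * (𝒜.barPerm o)⁻¹)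
    -- Go from `o` to `x | y` through `o | o` and `o | y`: the three quotients are the constant `n
    -- (o | o)`, the shift of `n y` (which takes `o | o` to `o | y`), and the conjugate of `n x`.
    rw [𝒜.barPerm_translation_mul_inv (𝒜.barPerm_mul_inv_mem y o) o (𝒜.bar o o),
      ← 𝒜.barPerm_bar_mul_inv o o x y]
    simp only [Equiv.Perm.mul_apply, barPerm_inv_apply, 𝒜.c6, barPerm_apply]
    group
  · intro x y x' y' h
    have := congrArg Translation.perm h
    change 𝒜.barPerm x * (𝒜.barPerm o)⁻¹ / (𝒜.barPerm y * (𝒜.barPerm o)⁻¹) =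
      𝒜.barPerm x' * (𝒜.barPerm o)⁻¹ / (𝒜.barPerm y' * (𝒜.barPerm o)⁻¹) at this
    simpa [div_eq_mul_inv] using this

end ConwayAlgebra

/-! ### The braid group on three strings: exponent sum and full twist -/

namespace BraidThree

theorem sigma_braid : sigma 0 * sigma 1 * sigma 0 = sigma 1 * sigma 0 * sigma 1 := by
  have h : PresentedGroup.mk braidThreeRels _ = 1 :=
    PresentedGroup.one_of_mem (rels := braidThreeRels) (Set.mem_singleton _)
  rw [map_mul, map_inv, mul_inv_eq_one] at h
  exact h

@[elab_as_elim]
theorem induction_left {p : BraidThree → Prop} (one : p 1)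
    (mul : ∀ i z, p z → p (sigma i * z)) (inv_mul : ∀ i z, p z → p ((sigma i)⁻¹ * z))
    (z : BraidThree) : p z := by
  obtain ⟨z, rfl⟩ := PresentedGroup.mk_surjective braidThreeRels z
  obtain ⟨u, rfl⟩ : ∃ u, FreeGroup.mk u = z := ⟨z.toWord, FreeGroup.mk_toWord⟩
  induction u with
  | nil => exact one
  | cons l u ih =>
    obtain ⟨i, b⟩ := l
    have h : FreeGroup.mk ((i, b) :: u) = FreeGroup.mk [(i, b)] * FreeGroup.mk u := by
      rw [FreeGroup.mul_mk]; rfl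
    rw [h, map_mul]
    cases b with
    | true => exact mul i _ ih
    | false =>
      have h2 : FreeGroup.mk [(i, false)] = (FreeGroup.of i)⁻¹ := by
        simp [FreeGroup.of, FreeGroup.inv_mk, FreeGroup.invRev]
      rw [h2, map_inv]
      exact inv_mul i _ ih

/-- The exponent sum. -/
def exponentHom : BraidThree →* Multiplicative ℤ :=
  PresentedGroup.toGroup (f := fun _ => Multiplicative.ofAdd 1) (by
    rintro _ rfl
    simp)

/-- The exponent sum as an integer. -/
def expo (z : BraidThree) : ℤ := (exponentHom z).toAdd

@[simp] theorem expo_one : expo 1 = 0 := by simp [expo]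

@[simp] theorem expo_mul (x y : BraidThree) : expo (x * y) = expo x + expo y := by simp [expo]

@[simp] theorem expo_inv (x : BraidThree) : expo x⁻¹ = -expo x := by simp [expo]

@[simp] theorem expo_zpow (x : BraidThree) (n : ℤ) : expo (x ^ n) = n * expo x := by
  simp [expo]

@[simp] theorem expo_sigma (i : Fin 2) : expo (sigma i) = 1 := by
  simp [expo, exponentHom, sigma]

theorem Delta_mul_sigma_zero : Delta * sigma 0 = sigma 1 * Delta := by
  rw [Delta, sigma_braid, mul_assoc, mul_assoc, ← mul_assoc (sigma 0), sigma_braid]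

theorem Delta_mul_sigma_one : Delta * sigma 1 = sigma 0 * Delta := by
  rw [Delta, mul_assoc, mul_assoc, ← mul_assoc (sigma 1), ← sigma_braid]

theorem commute_Delta_sq (z : BraidThree) : Commute (Delta ^ (2 : ℤ)) z := by
  have h : ∀ i, Commute (Delta ^ (2 : ℤ)) (sigma i) := by
    intro i
    have e : Delta ^ (2 : ℤ) = Delta * Delta := by rw [zpow_ofNat, pow_two]
    rw [e, commute_iff_eq]
    fin_cases i
    · change Delta * Delta * sigma 0 = sigma 0 * (Delta * Delta)
      rw [mul_assoc, Delta_mul_sigma_zero, ← mul_assoc, Delta_mul_sigma_one, mul_assoc]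
    · change Delta * Delta * sigma 1 = sigma 1 * (Delta * Delta)
      rw [mul_assoc, Delta_mul_sigma_one, ← mul_assoc, Delta_mul_sigma_zero, mul_assoc]
  induction z using induction_left with
  | one => exact Commute.one_right _
  | mul i z hz => exact (h i).mul_right hz
  | inv_mul i z hz => exact (h i).inv_right.mul_right hz

theorem commute_Delta_zpow (m : ℤ) (z : BraidThree) : Commute (Delta ^ (2 * m)) z := by
  rw [zpow_mul]
  exact (commute_Delta_sq z).zpow_left m

theorem commute_Delta_zpow_four (r : ℤ) (z : BraidThree) : Commute (Delta ^ (4 * r)) z := by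
  have h : 4 * r = 2 * (2 * r) := by ring
  rw [h]
  exact commute_Delta_zpow _ z

/-- Identifying the two generators leaves a cyclic group, in which the class of a braid is the power
of the generator given by its exponent sum. -/
theorem con_of_expo_eq (c : Con BraidThree) (hc : c (sigma 0) (sigma 1)) {y z : BraidThree}
    (h : expo y = expo z) : c y z := by
  have hi : ∀ i, c (sigma i) (sigma 0) := by
    intro i
    fin_cases i
    · exact c.refl _
    · exact c.symm hc
  have key : ∀ y, c y (sigma 0 ^ expo y) := by
    intro y
    induction y using induction_left with
    | one => simpa using c.refl 1
    | mul i y hy =>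
      rw [expo_mul, expo_sigma, zpow_add, zpow_one]
      exact c.mul (hi i) hy
    | inv_mul i y hy =>
      rw [expo_mul, expo_inv, expo_sigma, zpow_add, zpow_neg_one]
      exact c.mul (c.inv (hi i)) hy
  exact c.trans (key y) (h ▸ c.symm (key z))

/-! ### Functionals on braids with a Hecke relation -/

section Skein

variable {R N : Type*} [CommRing R] [AddCommGroup N] [Module R N] {s : Rˣ} {b : R} {c : N}

/-- A functional on braids with the quadratic relation of a Hecke algebra vanishes if it vanishes
on the six positive permutation braids. -/
theorem eq_zero_of_skein (V : BraidThree → N)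
    (hV : ∀ i x y, V (x * sigma i * sigma i * y) =
      (s : R) • V (x * y) + b • V (x * sigma i * y))
    (h1 : V 1 = 0) (h0 : ∀ i, V (sigma i) = 0) (h01 : V (sigma 0 * sigma 1) = 0)
    (h10 : V (sigma 1 * sigma 0) = 0) (hD : V Delta = 0) (z : BraidThree) : V z = 0 := by
  have hinv : ∀ i x y, V (x * y) = 0 → V (x * sigma i * y) = 0 →
      V (x * ((sigma i)⁻¹ * y)) = 0 := by
    intro i x y hx hy
    have h := hV i x ((sigma i)⁻¹ * ((sigma i)⁻¹ * y))
    have h' := hV i x ((sigma i)⁻¹ * y)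
    simp only [mul_assoc, mul_inv_cancel_left] at h h' hy
    rw [hx, hy, smul_zero, add_zero] at h'
    have := congrArg (fun n => ((s⁻¹ : Rˣ) : R) • n) h'
    simpa [smul_smul] using this.symm
  -- The induction needs all six permutation braids as left factors: they span a right ideal of the
  -- Hecke algebra that contains `1`.
  suffices H : V (1 * z) = 0 ∧ V (sigma 0 * z) = 0 ∧ V (sigma 1 * z) = 0 ∧
      V (sigma 0 * sigma 1 * z) = 0 ∧ V (sigma 1 * sigma 0 * z) = 0 ∧ V (Delta * z) = 0 by
    simpa using H.1
  have step : ∀ i z, (V (1 * z) = 0 ∧ V (sigma 0 * z) = 0 ∧ V (sigma 1 * z) = 0 ∧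
      V (sigma 0 * sigma 1 * z) = 0 ∧ V (sigma 1 * sigma 0 * z) = 0 ∧ V (Delta * z) = 0) →
      (V (1 * (sigma i * z)) = 0 ∧ V (sigma 0 * (sigma i * z)) = 0 ∧
      V (sigma 1 * (sigma i * z)) = 0 ∧ V (sigma 0 * sigma 1 * (sigma i * z)) = 0 ∧
      V (sigma 1 * sigma 0 * (sigma i * z)) = 0 ∧ V (Delta * (sigma i * z)) = 0) := by
    rintro i z ⟨z1, z2, z3, z4, z5, z6⟩
    have q : ∀ i x, V (x * z) = 0 → V (x * sigma i * z) = 0 →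
        V (x * sigma i * (sigma i * z)) = 0 := by
      intro i x hx hy
      rw [← mul_assoc, hV, hx, hy, smul_zero, smul_zero, add_zero]
    have z6' : V (sigma 1 * sigma 0 * sigma 1 * z) = 0 := by rw [← sigma_braid]; exact z6
    fin_cases i
    · refine ⟨?_, ?_, ?_, ?_, ?_, ?_⟩
      · rw [one_mul]; exact z2
      · simpa using q 0 1 z1 (by simpa using z2)
      · rw [← mul_assoc]; exact z5
      · rw [← mul_assoc]; exact z6
      · exact q 0 _ z3 z5
      · exact q 0 _ z4 z6
    · refine ⟨?_, ?_, ?_, ?_, ?_, ?_⟩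
      · rw [one_mul]; exact z3
      · rw [← mul_assoc]; exact z4
      · simpa using q 1 1 z1 (by simpa using z3)
      · exact q 1 _ z2 z4
      · rw [← mul_assoc]; exact z6'
      · rw [Delta, sigma_braid]; exact q 1 _ z5 z6'
  induction z using induction_left with
  | one =>
    simp only [mul_one]
    exact ⟨h1, h0 0, h0 1, h01, h10, hD⟩
  | mul i z hz => exact step i z hz
  | inv_mul i z hz =>
    have hz' := step i z hz
    simp only [← mul_assoc _ (sigma i) z] at hz'
    exact ⟨hinv i _ _ hz.1 hz'.1, hinv i _ _ hz.2.1 hz'.2.1, hinv i _ _ hz.2.2.1 hz'.2.2.1,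
      hinv i _ _ hz.2.2.2.1 hz'.2.2.2.1, hinv i _ _ hz.2.2.2.2.1 hz'.2.2.2.2.1,
      hinv i _ _ hz.2.2.2.2.2 hz'.2.2.2.2.2⟩

theorem smul_skein_inv (V : BraidThree → N)
    (hV : ∀ i x y, V (x * sigma i * sigma i * y) =
      (s : R) • V (x * y) + b • V (x * sigma i * y)) (i : Fin 2) (x y : BraidThree) :
    (s : R) • V (x * (sigma i)⁻¹ * y) = V (x * sigma i * y) - b • V (x * y) := by
  have h := hV i x ((sigma i)⁻¹ * y)
  simp only [mul_assoc, mul_inv_cancel_left] at h ⊢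
  rw [h, add_sub_cancel_right]

theorem neg_zpow_add (s : Rˣ) (m n : ℤ) :
    (((-s) ^ (m + n) : Rˣ) : R) = (((-s) ^ m : Rˣ) : R) * (((-s) ^ n : Rˣ) : R) := by
  rw [zpow_add, Units.val_mul]

/-- In the reduced Burau representation, the sum of a braid and its adjugate
`(-s) ^ expo z • z⁻¹` is a scalar. Accordingly, it is killed by every functional that satisfies the
Hecke relation and vanishes on `1` and on the corresponding element for `σ₁ σ₂`. -/
theorem add_neg_zpow_smul_inv_eq_zero (V : BraidThree → N)
    (hV : ∀ i x y, V (x * sigma i * sigma i * y) =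
      (s : R) • V (x * y) + b • V (x * sigma i * y))
    (h1 : V 1 = 0)
    (h2 : V (sigma 0 * sigma 1) + V (sigma 1 * sigma 0) = b • (V (sigma 0) + V (sigma 1)))
    (z : BraidThree) : V z + (((-s) ^ expo z : Rˣ) : R) • V z⁻¹ = 0 := by
  have hi := smul_skein_inv V hV
  have e1 : ((((-s) ^ (1 : ℤ) : Rˣ)) : R) = -s := by simp
  have e2 : ((((-s) ^ (1 + 1 : ℤ) : Rˣ)) : R) = s * s := by rw [neg_zpow_add, e1]; ring
  have hs : ∀ i, (s : R) • V (sigma i)⁻¹ = V (sigma i) := by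
    intro i
    have := hi i 1 1
    simpa [h1] using this
  have hss : ∀ i j, ((s : R) * s) • V ((sigma i)⁻¹ * (sigma j)⁻¹) =
      V (sigma i * sigma j) - b • (V (sigma i) + V (sigma j)) := by
    intro i j
    have k1 := hi j (sigma i)⁻¹ 1
    have k2 := hi i 1 (sigma j)
    have k3 := hs i
    simp only [one_mul, mul_one] at k1 k2
    linear_combination (norm := module) (s : R) • k1 + k2 - b • k3
  refine eq_zero_of_skein (s := s) (b := b)
    (fun z => V z + (((-s) ^ expo z : Rˣ) : R) • V z⁻¹) ?_ ?_ ?_ ?_ ?_ ?_ z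
  -- The second summand obeys the same quadratic relation as `V`: the element `-s σ⁻¹ = b - σ`
  -- satisfies `(b - σ)² = s + b (b - σ)`.
  · intro i x y
    have k1 := hV i x y
    have k2 := hi i y⁻¹ ((sigma i)⁻¹ * x⁻¹)
    simp only [mul_assoc, mul_inv_cancel_left] at k1 k2
    simp only [mul_inv_rev, expo_mul, expo_sigma, mul_assoc, k1]
    have w1 : (((-s) ^ (expo x + (1 + (1 + expo y))) : Rˣ) : R) =
        (((-s) ^ (expo x + expo y) : Rˣ) : R) * s * s := by
      rw [show expo x + (1 + (1 + expo y)) = (expo x + expo y) + (1 + 1) by ring,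
        neg_zpow_add, e2, mul_assoc]
    have w2 : (((-s) ^ (expo x + (1 + expo y)) : Rˣ) : R) =
        -((((-s) ^ (expo x + expo y) : Rˣ) : R) * s) := by
      rw [show expo x + (1 + expo y) = (expo x + expo y) + 1 by ring,
        neg_zpow_add, e1, mul_neg]
    rw [w1, w2]
    linear_combination (norm := module) ((((-s) ^ (expo x + expo y) : Rˣ) : R) * s) • k2
  · simp [h1]
  · intro i
    simp only [expo_sigma, e1]
    rw [neg_smul, hs, add_neg_cancel]
  · simp only [expo_mul, expo_sigma, mul_inv_rev, e2]
    rw [hss]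
    linear_combination (norm := module) h2
  · simp only [expo_mul, expo_sigma, mul_inv_rev, e2]
    rw [hss]
    linear_combination (norm := module) h2
  · have e3 : ((((-s) ^ (1 + 1 + 1 : ℤ) : Rˣ)) : R) = -(s * s * s) := by
      rw [neg_zpow_add, e1, e2]; ring
    simp only [Delta, expo_mul, expo_sigma, mul_inv_rev, e3]
    have k1 := hi 0 1 ((sigma 1)⁻¹ * (sigma 0)⁻¹)
    have k2 := hi 1 (sigma 0) (sigma 0)⁻¹
    have k3 := hi 0 (sigma 0 * sigma 1) 1
    have k4 := hss 1 0
    have k5 := hV 0 1 1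
    simp only [one_mul, mul_one, mul_inv_cancel, h1, mul_assoc] at k1 k2 k3 k5
    simp only [mul_assoc]
    linear_combination (norm := module) (-((s : R) * s)) • k1 - (s : R) • k2 - k3 + b • k4 + b • h2

variable {f : BraidThree → N}

/-- The braids that the full twist does not distinguish, up to the factor `s ^ 3`. -/
def fullTwistCon (s : Rˣ) (hcyc : ∀ x y, f (x * y) = f (y * x)) : Con BraidThree where
  r y z := ∀ x, f (x * Delta ^ (2 : ℤ) * y) - f (x * Delta ^ (2 : ℤ) * z) =
    ((s : R) ^ 3) • (f (x * y) - f (x * z))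
  iseqv :=
    { refl := fun y x => by simp
      symm := fun {y z} h x => by
        rw [← neg_sub, h x]; module
      trans := fun {y z t} h h' x => by
        linear_combination (norm := module) h x + h' x }
  -- Replace the two factors one after the other, through `z * y'`. Since `Δ²` is central and `f` is
  -- cyclic, each factor can be rotated to the right end.
  mul' := by
    intro y z y' z' h h' x
    have h1 := h (y' * x)
    have h2 := h' (x * z)
    have a1 : f (x * Delta ^ (2 : ℤ) * (y * y')) = f (y' * x * Delta ^ (2 : ℤ) * y) := by
      rw [← mul_assoc, hcyc]; simp only [mul_assoc]
    have a2 : f (y' * x * Delta ^ (2 : ℤ) * z) = f (x * z * Delta ^ (2 : ℤ) * y') := by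
      rw [mul_assoc x z, ← (commute_Delta_sq z).eq, mul_assoc, mul_assoc, hcyc]
    have a3 : f (x * z * Delta ^ (2 : ℤ) * z') = f (x * Delta ^ (2 : ℤ) * (z * z')) := by
      rw [mul_assoc x z, ← (commute_Delta_sq z).eq]; simp only [mul_assoc]
    have a4 : f (y' * x * y) = f (x * (y * y')) := by
      rw [mul_assoc, hcyc]; simp only [mul_assoc]
    have a5 : f (y' * x * z) = f (x * z * y') := by
      rw [mul_assoc, hcyc]
    rw [a1, ← a3, ← a4, ← mul_assoc x z z']
    rw [a2, a5] at h1
    linear_combination (norm := module) h1 + h2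

theorem trace_skein (hcyc : ∀ x y, f (x * y) = f (y * x))
    (hsk : ∀ i x, f (sigma i * sigma i * x) = (s : R) • f x + b • f (sigma i * x) + c)
    (i : Fin 2) (x y : BraidThree) : f (x * sigma i * sigma i * y) =
    (s : R) • f (x * y) + b • f (x * sigma i * y) + c := by
  have h := hsk i (y * x)
  rw [mul_assoc x, mul_assoc x, hcyc x, mul_assoc, h, hcyc x y, mul_assoc x, hcyc x, mul_assoc]

/-- With `Δ σ₁ = σ₁ σ₂ σ₁²` and `Δ σ₂ = σ₁² σ₂ σ₁`, the quadratic relation produces the same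
multiple of `f (x Δ)` in both terms. Together with `trace_Delta_sigma_sigma` this says that `Δ`
exchanges `σ₁ - σ₂` and `σ₁ σ₂ - σ₂ σ₁` with factors `s` and `s²`, so `Δ²` multiplies `σ₁ - σ₂` by
`s³`. -/
theorem trace_Delta_sigma (hcyc : ∀ x y, f (x * y) = f (y * x))
    (hsk : ∀ i x, f (sigma i * sigma i * x) = (s : R) • f x + b • f (sigma i * x) + c)
    (x : BraidThree) :
    f (x * Delta * sigma 0) - f (x * Delta * sigma 1) =
      (s : R) • (f (x * sigma 0 * sigma 1) - f (x * sigma 1 * sigma 0)) := by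
  have k1 := trace_skein hcyc hsk 0 (x * sigma 0 * sigma 1) 1
  have k2 := trace_skein hcyc hsk 0 x (sigma 1 * sigma 0)
  have e : x * Delta * sigma 1 = x * sigma 0 * sigma 0 * (sigma 1 * sigma 0) := by
    rw [mul_assoc, Delta_mul_sigma_one, Delta]; simp only [mul_assoc]
  rw [e, k2]
  simp only [Delta, mul_assoc, mul_one] at k1 ⊢
  rw [k1]
  module

theorem trace_Delta_sigma_sigma (hcyc : ∀ x y, f (x * y) = f (y * x))
    (hsk : ∀ i x, f (sigma i * sigma i * x) = (s : R) • f x + b • f (sigma i * x) + c)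
    (x : BraidThree) :
    f (x * Delta * sigma 0 * sigma 1) - f (x * Delta * sigma 1 * sigma 0) =
      ((s : R) ^ 2) • (f (x * sigma 0) - f (x * sigma 1)) := by
  have e1 : x * Delta * sigma 0 * sigma 1 = x * sigma 0 * sigma 1 * sigma 0 * sigma 0 * sigma 1 :=
    by simp only [Delta, mul_assoc]
  have e2 : x * Delta * sigma 1 * sigma 0 = x * sigma 1 * sigma 0 * sigma 1 * sigma 1 * sigma 0 :=
    by rw [Delta, sigma_braid]; simp only [mul_assoc]
  have e3 : x * sigma 0 * sigma 1 * sigma 0 * sigma 1 =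
      x * sigma 0 * sigma 0 * (sigma 1 * sigma 0) := by
    have h := congrArg (fun t => x * sigma 0 * t) sigma_braid
    simp only [mul_assoc] at h ⊢
    exact h.symm
  have e4 : x * sigma 1 * sigma 0 * sigma 1 * sigma 0 =
      x * sigma 1 * sigma 1 * (sigma 0 * sigma 1) := by
    have h := congrArg (fun t => x * sigma 1 * t) sigma_braid
    simp only [mul_assoc] at h ⊢
    exact h
  have e5 : x * (sigma 0 * sigma 1 * sigma 0) = x * (sigma 1 * sigma 0 * sigma 1) := by
    rw [sigma_braid]
  have k1 := trace_skein hcyc hsk 0 (x * sigma 0 * sigma 1) (sigma 1)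
  have k2 := trace_skein hcyc hsk 1 (x * sigma 0) 1
  have k3 := trace_skein hcyc hsk 0 x (sigma 1 * sigma 0)
  have k4 := trace_skein hcyc hsk 1 (x * sigma 1 * sigma 0) (sigma 0)
  have k5 := trace_skein hcyc hsk 0 (x * sigma 1) 1
  have k6 := trace_skein hcyc hsk 1 x (sigma 0 * sigma 1)
  rw [e1, e2, k1, k4, e3, e4, k3, k6]
  simp only [mul_one, mul_assoc] at k2 k5 e5 ⊢
  rw [k2, k5, e5]
  module

theorem trace_Delta_sq (hcyc : ∀ x y, f (x * y) = f (y * x))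
    (hsk : ∀ i x, f (sigma i * sigma i * x) = (s : R) • f x + b • f (sigma i * x) + c)
    {y z : BraidThree} (h : expo y = expo z) (x : BraidThree) :
    f (x * Delta ^ (2 : ℤ) * y) - f (x * Delta ^ (2 : ℤ) * z) =
      ((s : R) ^ 3) • (f (x * y) - f (x * z)) := by
  -- As `fullTwistCon` is a congruence, only `σ₁` and `σ₂` have to be compared.
  refine con_of_expo_eq (fullTwistCon s hcyc) ?_ h x
  intro x
  have h1 := trace_Delta_sigma hcyc hsk (x * Delta)
  have h2 := trace_Delta_sigma_sigma hcyc hsk x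
  have e : x * Delta ^ (2 : ℤ) = x * Delta * Delta := by
    rw [zpow_ofNat, pow_two, mul_assoc]
  rw [e]
  linear_combination (norm := module) h1 + (s : R) • h2

theorem trace_Delta_zpow (hcyc : ∀ x y, f (x * y) = f (y * x))
    (hsk : ∀ i x, f (sigma i * sigma i * x) = (s : R) • f x + b • f (sigma i * x) + c)
    {y z : BraidThree} (h : expo y = expo z) (m : ℤ) (x : BraidThree) :
    f (x * Delta ^ (2 * m) * y) - f (x * Delta ^ (2 * m) * z) =
      ((s ^ (3 * m) : Rˣ) : R) • (f (x * y) - f (x * z)) := by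
  induction m generalizing x with
  | zero => simp
  | succ m ih =>
    have h1 := trace_Delta_sq hcyc hsk h (x * Delta ^ (2 * (m : ℤ)))
    have e : x * Delta ^ (2 * ((m : ℤ) + 1)) = x * Delta ^ (2 * (m : ℤ)) * Delta ^ (2 : ℤ) := by
      rw [mul_assoc, ← zpow_add]; rfl
    have e' : ((s ^ (3 * ((m : ℤ) + 1)) : Rˣ) : R) = (s : R) ^ 3 * ((s ^ (3 * (m : ℤ)) : Rˣ) : R) := by
      rw [mul_add, zpow_add, Units.val_mul, mul_comm]; rfl
    rw [e, h1, ih, smul_smul, e']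
  | pred m ih =>
    have h1 := trace_Delta_sq hcyc hsk h (x * Delta ^ (2 * (-(m : ℤ) - 1)))
    have e : x * Delta ^ (2 * (-(m : ℤ) - 1)) * Delta ^ (2 : ℤ) = x * Delta ^ (2 * (-(m : ℤ))) := by
      rw [mul_assoc, ← zpow_add]; congr 2; ring
    have e' : ((s ^ (3 * (-(m : ℤ))) : Rˣ) : R) =
        (s : R) ^ 3 * ((s ^ (3 * (-(m : ℤ) - 1)) : Rˣ) : R) := by
      rw [show 3 * (-(m : ℤ)) = 3 + 3 * (-(m : ℤ) - 1) by ring, zpow_add, Units.val_mul]; rfl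
    rw [e, ih, e', ← smul_smul] at h1
    have h2 := congrArg (fun n => ((s⁻¹ ^ 3 : Rˣ) : R) • n) h1
    have e3 : ((s⁻¹ ^ 3 : Rˣ) : R) * (s : R) ^ 3 = 1 := by
      rw [← Units.val_pow_eq_pow_val, ← Units.val_mul, inv_pow, inv_mul_cancel, Units.val_one]
    simp only [smul_smul _ ((s : R) ^ 3), e3, one_smul] at h2
    exact h2.symm

/-- The sum of a braid and its dual is central in the Hecke algebra. -/
theorem trace_add_dual_commute (hcyc : ∀ x y, f (x * y) = f (y * x))
    (hsk : ∀ i x, f (sigma i * sigma i * x) = (s : R) • f x + b • f (sigma i * x) + c)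
    {r : ℤ} {z : BraidThree} (hz : expo z = 6 * r) (i : Fin 2)
    (x : BraidThree) :
    f (x * sigma i * z) + f (x * sigma i * (Delta ^ (4 * r) * z⁻¹)) =
      f (x * z * sigma i) + f (x * (Delta ^ (4 * r) * z⁻¹) * sigma i) := by
  have h1 := trace_Delta_zpow hcyc hsk (y := sigma i * z⁻¹) (z := z⁻¹ * sigma i)
    (by simp [add_comm]) (2 * r) x
  -- Apply Cayley–Hamilton to the commutator with `σᵢ`. It vanishes on `1`, and being a difference
  -- of values of `f` it loses the constant `c`.
  have h2 := add_neg_zpow_smul_inv_eq_zero (s := s) (b := b)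
    (fun z => f (x * sigma i * z) - f (x * z * sigma i)) (by
      intro j y z
      have k1 := trace_skein hcyc hsk j (x * sigma i * y) z
      have k2 := trace_skein hcyc hsk j (x * y) (z * sigma i)
      simp only [mul_assoc] at k1 k2 ⊢
      rw [k1, k2]
      module) (by simp) (by
      have k1 := trace_skein hcyc hsk i x (sigma 0)
      have k2 := trace_skein hcyc hsk i x (sigma 1)
      have k3 := trace_skein hcyc hsk i (x * sigma 0) 1
      have k4 := trace_skein hcyc hsk i (x * sigma 1) 1
      fin_cases i
      · simp only [mul_assoc, mul_one, Fin.zero_eta] at k1 k2 k3 k4 ⊢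
        rw [k2, k4]
        module
      · simp only [mul_assoc, mul_one, Fin.mk_one] at k1 k2 k3 k4 ⊢
        rw [k1, k3]
        module) z
  -- As `6r` is even, `(-s)^(6r) = s^(6r)`, which is the factor that `Δ^(4r)` contributes in `h1`.
  rw [hz, Even.neg_zpow (⟨3 * r, by ring⟩ : Even (6 * r))] at h2
  rw [show 3 * (2 * r) = 6 * r by ring, show 2 * (2 * r) = 4 * r by ring] at h1
  have e1 : x * sigma i * (Delta ^ (4 * r) * z⁻¹) = x * Delta ^ (4 * r) * (sigma i * z⁻¹) := by
    have := (commute_Delta_zpow_four r (sigma i)).eq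
    simp only [mul_assoc] at this ⊢
    rw [← mul_assoc (sigma i), ← this, mul_assoc]
  have e2 : x * (Delta ^ (4 * r) * z⁻¹) * sigma i = x * Delta ^ (4 * r) * (z⁻¹ * sigma i) := by
    simp only [mul_assoc]
  rw [e1, e2]
  simp only [mul_assoc] at h1 h2 ⊢
  linear_combination (norm := module) h1 + h2

/-- The dual of `g z g⁻¹` is the conjugate by `g` of the dual of `z`, so centrality of the sum,
applied one generator of `g` at a time, removes the conjugation. -/
theorem trace_add_dual_conj (hcyc : ∀ x y, f (x * y) = f (y * x))
    (hsk : ∀ i x, f (sigma i * sigma i * x) = (s : R) • f x + b • f (sigma i * x) + c)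
    {r : ℤ} {z : BraidThree} (hz : expo z = 6 * r)
    (t g : BraidThree) :
    f (t * (g * z * g⁻¹)) + f (t * (Delta ^ (4 * r) * (g * z * g⁻¹)⁻¹)) =
      f (t * z) + f (t * (Delta ^ (4 * r) * z⁻¹)) := by
  have key : ∀ i (t z : BraidThree), expo z = 6 * r →
      f (t * (sigma i * z * (sigma i)⁻¹)) +
        f (t * (Delta ^ (4 * r) * (sigma i * z * (sigma i)⁻¹)⁻¹)) =
      f (t * z) + f (t * (Delta ^ (4 * r) * z⁻¹)) := by
    intro i t z hz
    have h := trace_add_dual_commute hcyc hsk hz i ((sigma i)⁻¹ * t)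
    have h1 : f (t * (sigma i * z * (sigma i)⁻¹)) = f ((sigma i)⁻¹ * t * sigma i * z) := by
      rw [← mul_assoc, hcyc]; simp only [mul_assoc]
    have h2 : f (t * (Delta ^ (4 * r) * (sigma i * z * (sigma i)⁻¹)⁻¹)) =
        f ((sigma i)⁻¹ * t * sigma i * (Delta ^ (4 * r) * z⁻¹)) := by
      rw [mul_inv_rev, mul_inv_rev, inv_inv, ← mul_assoc (sigma i), ← mul_assoc (Delta ^ _),
        ← mul_assoc (Delta ^ _), (commute_Delta_zpow_four r (sigma i)).eq, ← mul_assoc, hcyc]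
      simp only [mul_assoc]
    have h3 : f ((sigma i)⁻¹ * t * z * sigma i) = f (t * z) := by
      rw [hcyc]; simp only [mul_assoc, mul_inv_cancel_left]
    have h4 : f ((sigma i)⁻¹ * t * (Delta ^ (4 * r) * z⁻¹) * sigma i) =
        f (t * (Delta ^ (4 * r) * z⁻¹)) := by
      rw [hcyc]; simp only [mul_assoc, mul_inv_cancel_left]
    rw [h1, h2, h, h3, h4]
  induction g using induction_left generalizing t with
  | one => simp
  | mul i g hg =>
    have h := key i t (g * z * g⁻¹) (by simp [hz])
    rw [hg] at h
    rw [← h]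
    simp only [mul_inv_rev, mul_assoc]
  | inv_mul i g hg =>
    have h := key i t ((sigma i)⁻¹ * g * z * ((sigma i)⁻¹ * g)⁻¹) (by simp [hz]; ring)
    have e : sigma i * ((sigma i)⁻¹ * g * z * ((sigma i)⁻¹ * g)⁻¹) * (sigma i)⁻¹ =
      g * z * g⁻¹ := by group
    rw [e, hg] at h
    exact h.symm

/-- Conjugation by `Δ` takes `σ₁` to `σ₂`; cyclicity moves it onto `z`, where `trace_add_dual_conj`
absorbs it. -/
theorem trace_add_dual_sigma_inv (hcyc : ∀ x y, f (x * y) = f (y * x))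
    (hsk : ∀ i x, f (sigma i * sigma i * x) = (s : R) • f x + b • f (sigma i * x) + c)
    {r : ℤ} {z : BraidThree} (hz : expo z = 6 * r) (i j : Fin 2) :
    f ((sigma i)⁻¹ * z) + f ((sigma i)⁻¹ * (Delta ^ (4 * r) * z⁻¹)) =
      f ((sigma j)⁻¹ * z) + f ((sigma j)⁻¹ * (Delta ^ (4 * r) * z⁻¹)) := by
  suffices key : ∀ j, f ((sigma j)⁻¹ * z) + f ((sigma j)⁻¹ * (Delta ^ (4 * r) * z⁻¹)) =
      f ((sigma 0)⁻¹ * z) + f ((sigma 0)⁻¹ * (Delta ^ (4 * r) * z⁻¹)) by rw [key i, key j]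
  intro j
  fin_cases j
  · rfl
  · have h := trace_add_dual_conj hcyc hsk hz (sigma 0)⁻¹ Delta⁻¹
    have e : (sigma 1)⁻¹ = Delta * (sigma 0)⁻¹ * Delta⁻¹ := by
      have := Delta_mul_sigma_zero
      rw [inv_eq_iff_eq_inv, mul_inv_rev, mul_inv_rev, inv_inv, inv_inv, ← mul_assoc, this,
        mul_inv_cancel_right]
    change f ((sigma 1)⁻¹ * z) + f ((sigma 1)⁻¹ * (Delta ^ (4 * r) * z⁻¹)) = _
    rw [← h, e]
    congr 1
    · rw [mul_assoc, mul_assoc, hcyc]; simp only [mul_assoc, inv_inv]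
    · have c := (commute_Delta_zpow_four r Delta⁻¹).eq
      rw [mul_assoc, mul_assoc, hcyc, ← mul_assoc Delta⁻¹ (Delta ^ _), ← c]
      simp only [mul_inv_rev, inv_inv, mul_assoc]

end Skein

end BraidThree

/-! ### Self-dual braids and the exchange of crossings -/

namespace BraidThree

universe u

section Conway

variable {A : Type u} {W : BraidThree → A}

/-- The value of `W` on `z` agrees with that on the dual braid. -/
def SelfDual (W : BraidThree → A) (r : ℤ) (z : BraidThree) : Prop :=
  W z = W (Delta ^ (4 * r) * z⁻¹)

theorem selfDual_mul_comm (hcyc : ∀ x y, W (x * y) = W (y * x)) (r : ℤ) (x y : BraidThree) :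
    SelfDual W r (x * y) ↔ SelfDual W r (y * x) := by
  have h : W (Delta ^ (4 * r) * (x * y)⁻¹) = W (Delta ^ (4 * r) * (y * x)⁻¹) := by
    rw [mul_inv_rev, mul_inv_rev, ← mul_assoc, hcyc, ← mul_assoc,
      ← (commute_Delta_zpow_four r x⁻¹).eq, mul_assoc]
  rw [SelfDual, SelfDual, h, hcyc x y]

/-- Two crossing changes act on the value of the braid, and two on the value of its dual, by
quotients `R_p R_q⁻¹`. The linearized trace identity shows that these are the same permutation, so
equality of the two values is preserved in both directions. -/
theorem selfDual_exchange (𝒜 : ConwayAlgebra A) (hcyc : ∀ x y, W (x * y) = W (y * x))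
    (hskein : ∀ i x, W (sigma i * x) = 𝒜.bar (W ((sigma i)⁻¹ * x)) (W x))
    {r : ℤ} {x y : BraidThree} (hxy : expo (x * y) = 6 * r) (i j : Fin 2) :
    SelfDual W r (x * sigma i * y * (sigma j)⁻¹) ↔ SelfDual W r (x * (sigma i)⁻¹ * y * sigma j) := by
  obtain ⟨R, N, _, _, _, s, b, c, n, hn, hperm⟩ := 𝒜.exists_linearization
  have hf : ∀ x y, n (W (x * y)) = n (W (y * x)) := fun x y => by rw [hcyc]
  have hsk : ∀ i x, n (W (sigma i * sigma i * x)) =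
      (s : R) • n (W x) + b • n (W (sigma i * x)) + c := by
    intro i x
    have h := hskein i (sigma i * x)
    rw [inv_mul_cancel_left, ← mul_assoc] at h
    rw [h, hn, Units.smul_def]
  have hmid : ∀ i x y, W (x * sigma i * y) =
      𝒜.barPerm (W (x * y)) (W (x * (sigma i)⁻¹ * y)) := by
    intro i x y
    have h := hskein i (y * x)
    rw [ConwayAlgebra.barPerm_apply, mul_assoc, hcyc x, mul_assoc, h, mul_assoc, hcyc x (_ * _),
      mul_assoc, hcyc x y]
  have hmid' : ∀ i x y, W (x * (sigma i)⁻¹ * y) =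
      (𝒜.barPerm (W (x * y)))⁻¹ (W (x * sigma i * y)) := by
    intro i x y
    rw [hmid]; exact (Equiv.symm_apply_apply _ _).symm
  have h1 : W (x * (sigma i)⁻¹ * y * sigma j) =
      (𝒜.barPerm (W (x * (sigma i)⁻¹ * y)) * (𝒜.barPerm (W (x * y * (sigma j)⁻¹)))⁻¹)
        (W (x * sigma i * y * (sigma j)⁻¹)) := by
    have k1 := hmid j (x * (sigma i)⁻¹ * y) 1
    have k2 := hmid' i x (y * (sigma j)⁻¹)
    simp only [mul_one, ← mul_assoc] at k1 k2
    rw [k1, k2, Equiv.Perm.mul_apply]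
  have h2 : W (Delta ^ (4 * r) * (x * (sigma i)⁻¹ * y * sigma j)⁻¹) =
      (𝒜.barPerm (W (Delta ^ (4 * r) * (sigma j)⁻¹ * y⁻¹ * x⁻¹)) *
        (𝒜.barPerm (W (Delta ^ (4 * r) * y⁻¹ * (sigma i)⁻¹ * x⁻¹)))⁻¹)
        (W (Delta ^ (4 * r) * (x * sigma i * y * (sigma j)⁻¹)⁻¹)) := by
    have k1 := hmid i (Delta ^ (4 * r) * (sigma j)⁻¹ * y⁻¹) x⁻¹
    have k2 := hmid' j (Delta ^ (4 * r)) (y⁻¹ * (sigma i)⁻¹ * x⁻¹)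
    simp only [← mul_assoc] at k1 k2
    simp only [mul_inv_rev, inv_inv, ← mul_assoc]
    rw [k1, k2, Equiv.Perm.mul_apply]
  -- Smoothing `σᵢ` or `σⱼ` leaves `σⱼ⁻¹ x y` or `σᵢ⁻¹ y x` up to conjugacy. Hence `t1` exchanges
  -- `i` for `j`, and `t2` passes from `y x` to its conjugate `x y`.
  have hyx : expo (y * x) = 6 * r := by rw [← hxy, expo_mul, expo_mul, add_comm]
  have t1 := trace_add_dual_sigma_inv (f := fun z => n (W z)) hf hsk hyx i j
  have t2 := trace_add_dual_conj (f := fun z => n (W z)) hf hsk hyx (sigma j)⁻¹ x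
  have e0 : x * (y * x) * x⁻¹ = x * y := by group
  rw [e0] at t2
  have w1 : W (x * (sigma i)⁻¹ * y) = W ((sigma i)⁻¹ * (y * x)) := by
    rw [mul_assoc, hcyc, mul_assoc]
  have w2 : W (x * y * (sigma j)⁻¹) = W ((sigma j)⁻¹ * (x * y)) := hcyc _ _
  have w3 : W (Delta ^ (4 * r) * (sigma j)⁻¹ * y⁻¹ * x⁻¹) =
      W ((sigma j)⁻¹ * (Delta ^ (4 * r) * (x * y)⁻¹)) := by
    rw [(commute_Delta_zpow_four r _).eq]; simp only [mul_inv_rev, mul_assoc]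
  have w4 : W (Delta ^ (4 * r) * y⁻¹ * (sigma i)⁻¹ * x⁻¹) =
      W ((sigma i)⁻¹ * (Delta ^ (4 * r) * (y * x)⁻¹)) := by
    have h := (commute_Delta_zpow_four r x⁻¹).eq
    rw [mul_assoc, hcyc, mul_inv_rev, ← mul_assoc (Delta ^ _), h]
    simp only [mul_assoc]
  have hq := hperm (W (x * (sigma i)⁻¹ * y)) (W (x * y * (sigma j)⁻¹))
    (W (Delta ^ (4 * r) * (sigma j)⁻¹ * y⁻¹ * x⁻¹))
    (W (Delta ^ (4 * r) * y⁻¹ * (sigma i)⁻¹ * x⁻¹)) (by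
      rw [w1, w2, w3, w4]
      rw [sub_eq_sub_iff_add_eq_add, add_comm (n (W ((sigma j)⁻¹ * _)))]
      exact t1.trans t2.symm)
  rw [SelfDual, SelfDual, h1, h2, hq]
  exact (Equiv.apply_eq_iff_eq _).symm

/-- Braids that can be exchanged for each other as factors of self-dual braids. -/
def selfDualCon (hcyc : ∀ x y, W (x * y) = W (y * x)) (r : ℤ) : Con BraidThree where
  r y z := expo y = expo z ∧
    ∀ x, expo (x * y) = 6 * r → (SelfDual W r (x * y) ↔ SelfDual W r (x * z))
  iseqv :=
    { refl := fun y => ⟨rfl, fun _ _ => Iff.rfl⟩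
      symm := fun {y z} h => ⟨h.1.symm, fun x hx => (h.2 x (by simpa [h.1] using hx)).symm⟩
      trans := fun {y z t} h h' => ⟨h.1.trans h'.1, fun x hx =>
        (h.2 x hx).trans (h'.2 x (by simpa [h.1] using hx))⟩ }
  mul' := by
    rintro y z y' z' ⟨h1, h2⟩ ⟨h1', h2'⟩
    refine ⟨by simp [h1, h1'], fun x hx => ?_⟩
    have k1 := h2 (y' * x) (by rw [← hx]; simp only [expo_mul]; ring)
    have k2 := h2' (x * z) (by rw [← hx]; simp only [expo_mul, h1]; ring)
    rw [← mul_assoc, selfDual_mul_comm hcyc, ← mul_assoc, k1, mul_assoc, selfDual_mul_comm hcyc,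
      k2, mul_assoc]

/-- This is the exchange for `x σᵢ` and `y σⱼ`: on one side the letters `σⱼ σⱼ⁻¹` cancel, on the
other `σᵢ σᵢ⁻¹`. -/
theorem selfDualCon_sq (𝒜 : ConwayAlgebra A) (hcyc : ∀ x y, W (x * y) = W (y * x))
    (hskein : ∀ i x, W (sigma i * x) = 𝒜.bar (W ((sigma i)⁻¹ * x)) (W x))
    (r : ℤ) (i j : Fin 2) (y : BraidThree) :
    selfDualCon hcyc r (sigma i * (sigma i * y)) (y * (sigma j * sigma j)) := by
  refine ⟨by simp only [expo_mul, expo_sigma]; ring, fun x hx => ?_⟩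
  have h := selfDual_exchange 𝒜 hcyc hskein (r := r) (x := x * sigma i) (y := y * sigma j) (by
    rw [← hx]; simp only [expo_mul, expo_sigma]; ring) i j
  simp only [mul_assoc, mul_inv_cancel, mul_one] at h ⊢
  exact h

/-- Modulo a congruence for which the squares of the generators are equal and central, every
braid is a permutation braid times a power of such a square. -/
theorem exists_con_permutation_mul (c : Con BraidThree)
    (hc : ∀ i y, c (sigma i * (sigma i * y)) (y * (sigma 0 * sigma 0))) (z : BraidThree) :
    ∃ k : ℤ, ∃ t ∈ ({1, sigma 0, sigma 1, sigma 0 * sigma 1, sigma 1 * sigma 0, Delta} :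
      Set BraidThree), c z (t * (sigma 0 * sigma 0) ^ k) := by
  have hstep : ∀ i z, (∃ k : ℤ, ∃ t ∈ ({1, sigma 0, sigma 1, sigma 0 * sigma 1,
      sigma 1 * sigma 0, Delta} : Set BraidThree), c z (t * (sigma 0 * sigma 0) ^ k)) →
      ∃ k : ℤ, ∃ t ∈ ({1, sigma 0, sigma 1, sigma 0 * sigma 1,
      sigma 1 * sigma 0, Delta} : Set BraidThree),
        c (sigma i * z) (t * (sigma 0 * sigma 0) ^ k) := by
    rintro i z ⟨k, t, ht, h⟩
    suffices H : ∃ k' : ℤ, ∃ t' ∈ ({1, sigma 0, sigma 1, sigma 0 * sigma 1,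
        sigma 1 * sigma 0, Delta} : Set BraidThree),
        c (sigma i * t) (t' * (sigma 0 * sigma 0) ^ k') by
      obtain ⟨k', t', ht', h'⟩ := H
      refine ⟨k' + k, t', ht', c.trans (c.mul (c.refl _) h) ?_⟩
      rw [zpow_add, ← mul_assoc, ← mul_assoc]
      exact c.mul h' (c.refl _)
    have stay : ∀ {x t' : BraidThree}, x = t' → c x (t' * (sigma 0 * sigma 0) ^ (0 : ℤ)) := by
      rintro x _ rfl
      rw [zpow_zero, mul_one]
      exact c.refl _
    have fold : ∀ {x : BraidThree} (i) (y), x = sigma i * (sigma i * y) →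
        c x (y * (sigma 0 * sigma 0) ^ (1 : ℤ)) := by
      rintro x i y rfl
      rw [zpow_one]
      exact hc i y
    -- A generator on the left either lengthens the permutation braid (`stay`) or meets an equal
    -- first letter, so that a square comes out (`fold`).
    rcases ht with rfl | rfl | rfl | rfl | rfl | rfl <;> fin_cases i
    · exact ⟨0, _, by simp, stay (mul_one (sigma 0))⟩
    · exact ⟨0, _, by simp, stay (mul_one (sigma 1))⟩
    · exact ⟨1, 1, by simp, fold 0 1 (by simp)⟩
    · exact ⟨0, sigma 1 * sigma 0, by simp, stay rfl⟩
    · exact ⟨0, sigma 0 * sigma 1, by simp, stay rfl⟩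
    · exact ⟨1, 1, by simp, fold 1 1 (by simp)⟩
    · exact ⟨1, sigma 1, by simp, fold 0 _ rfl⟩
    · exact ⟨0, Delta, by simp, stay (by
        rw [Delta, sigma_braid]; simp only [mul_assoc, Fin.mk_one])⟩
    · exact ⟨0, Delta, by simp, stay (by
        rw [Delta]; simp only [mul_assoc, Fin.zero_eta])⟩
    · exact ⟨1, sigma 0, by simp, fold 1 _ rfl⟩
    · exact ⟨1, sigma 1 * sigma 0, by simp, fold 0 _ (by
        rw [Delta]; simp only [mul_assoc, Fin.zero_eta])⟩
    · exact ⟨1, sigma 0 * sigma 1, by simp, fold 1 _ (by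
        rw [Delta, sigma_braid]; simp only [mul_assoc, Fin.mk_one])⟩
  induction z using induction_left with
  | one => exact ⟨0, 1, by simp, by simpa using c.refl 1⟩
  | mul i z hz => exact hstep i z hz
  | inv_mul i z hz =>
    obtain ⟨k, t, ht, h⟩ := hstep i z hz
    refine ⟨k - 1, t, ht, ?_⟩
    have h1 := hc i ((sigma i)⁻¹ * z)
    rw [mul_inv_cancel_left] at h1
    have h2 := c.mul (c.trans (c.symm h1) h) (c.refl (sigma 0 * sigma 0)⁻¹)
    rwa [mul_inv_cancel_right, mul_assoc, ← zpow_sub_one] at h2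

theorem selfDual_Delta_zpow (r : ℤ) : SelfDual W r (Delta ^ (2 * r)) := by
  rw [SelfDual, ← zpow_neg, ← zpow_add]
  congr 2
  ring

/-- The dual is `Δ^(2r) σⱼ σᵢ⁻¹`. Conjugation by `Δ` exchanges the two generators and fixes the
central factor. -/
theorem selfDual_sigma_mul_sigma_inv (hcyc : ∀ x y, W (x * y) = W (y * x)) (r : ℤ)
    {i j : Fin 2} (hij : i ≠ j) : SelfDual W r (sigma i * (sigma j)⁻¹ * Delta ^ (2 * r)) := by
  have e : Delta ^ (4 * r) * (sigma i * (sigma j)⁻¹ * Delta ^ (2 * r))⁻¹ =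
      Delta ^ (2 * r) * (sigma j * (sigma i)⁻¹) := by
    rw [mul_inv_rev, mul_inv_rev, inv_inv, ← mul_assoc, ← zpow_neg, ← zpow_add]
    congr 2
    ring
  have hD : ∀ i j : Fin 2, i ≠ j → Delta * sigma i * Delta⁻¹ = sigma j := by
    intro i j hij
    fin_cases i <;> fin_cases j <;> first | exact absurd rfl hij | skip
    · exact mul_inv_eq_iff_eq_mul.2 Delta_mul_sigma_zero
    · exact mul_inv_eq_iff_eq_mul.2 Delta_mul_sigma_one
  have e2 : Delta * (sigma i * (sigma j)⁻¹) * Delta⁻¹ = sigma j * (sigma i)⁻¹ := by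
    have h : Delta * (sigma i * (sigma j)⁻¹) * Delta⁻¹ =
        Delta * sigma i * Delta⁻¹ * (Delta * sigma j * Delta⁻¹)⁻¹ := by group
    rw [h, hD i j hij, hD j i hij.symm]
  have e3 : sigma i * (sigma j)⁻¹ * Delta⁻¹ * Delta ^ (2 * r) * Delta =
      sigma i * (sigma j)⁻¹ * Delta ^ (2 * r) := by
    rw [mul_assoc _ (Delta⁻¹), ← (commute_Delta_zpow r Delta⁻¹).eq, ← mul_assoc,
      inv_mul_cancel_right]
  rw [SelfDual, e, ← e2, ← e3, hcyc, hcyc (Delta ^ (2 * r))]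
  simp only [mul_assoc]

/-- A function on braids with the properties of an invariant of closed braids yielded by a Conway
algebra agrees on a braid and its dual. -/
theorem eq_dual_of_expo_eq (𝒜 : ConwayAlgebra A) (hcyc : ∀ x y, W (x * y) = W (y * x))
    (hskein : ∀ i x, W (sigma i * x) = 𝒜.bar (W ((sigma i)⁻¹ * x)) (W x))
    {r : ℤ} {z : BraidThree} (hz : expo z = 6 * r) :
    W z = W (Delta ^ (4 * r) * z⁻¹) := by
  have hsq := selfDualCon_sq 𝒜 hcyc hskein r
  set c := selfDualCon hcyc r with hcdef
  obtain ⟨k, t, ht, h⟩ := exists_con_permutation_mul c (fun i y => hsq i 0 y) z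
  have htr : ∀ {y}, c z y → SelfDual W r y → SelfDual W r z := by
    intro y hy hy'
    have := hy.2 1 (by simpa using hz)
    rw [one_mul, one_mul] at this
    exact this.2 hy'
  have hexp := h.1
  -- In `Δ² = σ₁ σ₂ σ₁² σ₂ σ₁` the inner square moves out to the right, which brings the two `σ₂`
  -- together; then the same happens with the `σ₁`.
  have hΔ : c (Delta ^ (2 : ℤ)) ((sigma 0 * sigma 0) ^ (3 : ℤ)) := by
    have e1 : Delta ^ (2 : ℤ) = sigma 0 * sigma 1 * (sigma 0 * (sigma 0 * (sigma 1 * sigma 0))) := by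
      rw [zpow_ofNat, pow_two, Delta]; simp only [mul_assoc]
    have e2 : sigma 0 * sigma 1 * (sigma 1 * sigma 0 * (sigma 0 * sigma 0)) =
        sigma 0 * (sigma 1 * (sigma 1 * sigma 0)) * (sigma 0 * sigma 0) := by
      simp only [mul_assoc]
    have e3 : sigma 0 * (sigma 0 * (sigma 0 * sigma 0)) * (sigma 0 * sigma 0) =
        (sigma 0 * sigma 0) ^ (3 : ℤ) := by
      rw [zpow_ofNat, pow_succ, pow_two]; simp only [mul_assoc]
    rw [e1]
    refine c.trans (c.mul (c.refl _) (hsq 0 0 _)) ?_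
    rw [e2, ← e3]
    exact c.mul (c.mul (c.refl _) (hsq 1 0 _)) (c.refl _)
  have hΔr : c ((sigma 0 * sigma 0) ^ (3 * r)) (Delta ^ (2 * r)) := by
    rw [zpow_mul, zpow_mul]
    exact c.zpow r (c.symm hΔ)
  have hinv : ∀ i j, c (sigma i * sigma j * (sigma 0 * sigma 0)⁻¹) (sigma i * (sigma j)⁻¹) := by
    intro i j
    have h1 := hsq j 0 (sigma j)⁻¹
    rw [mul_inv_cancel, mul_one] at h1
    have h2 := c.mul (c.mul (c.refl (sigma i)) h1) (c.refl (sigma 0 * sigma 0)⁻¹)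
    rwa [mul_assoc, mul_assoc, mul_assoc, mul_inv_cancel, mul_one, ← mul_assoc] at h2
  have two : ∀ i j, i ≠ j → c z (sigma i * sigma j * (sigma 0 * sigma 0) ^ k) →
      SelfDual W r z := by
    intro i j hij h
    have hexp := h.1
    have hk : k = -1 + 3 * r := by
      simp only [expo_mul, expo_zpow, expo_sigma, hz] at hexp
      omega
    refine htr (c.trans h ?_) (selfDual_sigma_mul_sigma_inv hcyc r hij)
    rw [hk, zpow_add, zpow_neg_one, ← mul_assoc]
    exact c.mul (hinv i j) hΔr
  simp only [expo_mul, expo_zpow, expo_sigma, hz] at hexp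
  -- The exponent sum `6r` is even, which excludes the permutation braids of odd length `σ₁`, `σ₂`
  -- and `Δ`.
  rcases ht with rfl | rfl | rfl | rfl | rfl | rfl
  · have hk : k = 3 * r := by simp only [expo_one] at hexp; omega
    rw [one_mul, hk] at h
    exact htr (c.trans h hΔr) (selfDual_Delta_zpow r)
  · rw [expo_sigma] at hexp; omega
  · rw [expo_sigma] at hexp; omega
  · exact two 0 1 (by decide) h
  · exact two 1 0 (by decide) h
  · simp only [Delta, expo_mul, expo_sigma] at hexp; omega

end Conway

end BraidThree

/-! ### Planarity under renaming and marking of points -/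

theorem Nat.card_quot_eq {α β : Type*} {r : α → α → Prop} {r' : β → β → Prop}
    (φ : α → β) (ψ : β → α) (hφ : ∀ a b, r a b → Quot.mk r' (φ a) = Quot.mk r' (φ b))
    (hψ : ∀ a b, r' a b → Quot.mk r (ψ a) = Quot.mk r (ψ b))
    (h1 : ∀ a, Quot.mk r (ψ (φ a)) = Quot.mk r a)
    (h2 : ∀ b, Quot.mk r' (φ (ψ b)) = Quot.mk r' b) :
    Nat.card (Quot r) = Nat.card (Quot r') :=
  Nat.card_congr
    { toFun := Quot.lift (fun a => Quot.mk r' (φ a)) hφ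
      invFun := Quot.lift (fun b => Quot.mk r (ψ b)) hψ
      left_inv := fun x => Quot.inductionOn x h1
      right_inv := fun x => Quot.inductionOn x h2 }

theorem Crossing.map_injective {P Q : Type} {e : P → Q} (he : Function.Injective e) :
    Function.Injective (Crossing.map e) := by
  rintro ⟨a, b, s⟩ ⟨a', b', s'⟩ h
  simp only [Crossing.map, Crossing.mk.injEq] at h
  rw [he h.1, he h.2.1, h.2.2]

theorem Crossing.meets_map {P Q : Type} {e : P → Q} (he : Function.Injective e)
    (c : Crossing P) (p : P) : (c.map e).Meets (e p) ↔ c.Meets p := by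
  simp [Crossing.Meets, Crossing.map, he.eq_iff]

namespace Diagram

variable {P Q : Type}

theorem ext' {D D' : Diagram P} (hn : D.next = D'.next) (hc : D.crossings = D'.crossings) :
    D = D' := by
  cases D; cases D'; simp only at hn hc; subst hn; subst hc; rfl

/-- The image of a diagram under a renaming of the marked points. -/
def relabel (D : Diagram P) (e : P ≃ Q) : Diagram Q where
  next := e.permCongr D.next
  crossings := Crossing.map e '' D.crossings
  left_ne_right := by
    rintro _ ⟨c, hc, rfl⟩ h
    exact D.left_ne_right c hc (e.injective h)
  eq_of_meets := by
    rintro _ ⟨c, hc, rfl⟩ _ ⟨d, hd, rfl⟩ p hp hp'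
    obtain ⟨q, rfl⟩ := e.surjective p
    rw [Crossing.meets_map e.injective] at hp hp'
    rw [D.eq_of_meets c hc d hd q hp hp']

theorem relabel_next (D : Diagram P) (e : P ≃ Q) (p : P) :
    (D.relabel e).next (e p) = e (D.next p) := by
  simp [relabel]

theorem relabel_next_symm (D : Diagram P) (e : P ≃ Q) (p : P) :
    (D.relabel e).next.symm (e p) = e (D.next.symm p) := by
  rw [Equiv.symm_apply_eq, relabel_next, Equiv.apply_symm_apply]

theorem relabel_relabel_symm (D : Diagram P) (e : P ≃ Q) : (D.relabel e).relabel e.symm = D := by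
  refine ext' ?_ ?_
  · ext p; simp [relabel]
  · simp only [relabel, Set.image_image]
    convert Set.image_id D.crossings using 2
    simp [Crossing.map]

theorem move_relabel (D : Diagram P) (e : P ≃ Q) : D.Move (D.relabel e) :=
  Move.relabel D _ e (D.relabel_next e) rfl

theorem Corner.relabel {D : Diagram P} (e : P ≃ Q) {x y : P × Bool} (h : D.Corner x y) :
    (D.relabel e).Corner (e x.1, x.2) (e y.1, y.2) := by
  cases h with
  | left c hc =>
    have := Corner.left (D := D.relabel e) (c.map e) ⟨c, hc, rfl⟩
    rwa [show (c.map e).left = e c.left from rfl, relabel_next_symm] at this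
  | right c hc =>
    have := Corner.right (D := D.relabel e) (c.map e) ⟨c, hc, rfl⟩
    rwa [show (c.map e).right = e c.right from rfl, relabel_next_symm] at this
  | top c hc => exact Corner.top (D := D.relabel e) (c.map e) ⟨c, hc, rfl⟩
  | bottom c hc =>
    have := Corner.bottom (D := D.relabel e) (c.map e) ⟨c, hc, rfl⟩
    rwa [show (c.map e).left = e c.left from rfl, relabel_next_symm,
      show (c.map e).right = e c.right from rfl, relabel_next_symm] at this
  | pass p hp b =>
    have := Corner.pass (D := D.relabel e) (e p) (by
      rintro _ ⟨c, hc, rfl⟩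
      rw [Crossing.meets_map e.injective]
      exact hp c hc) b
    rwa [relabel_next_symm] at this

theorem Linked.relabel {D : Diagram P} (e : P ≃ Q) {x y : P} (h : D.Linked x y) :
    (D.relabel e).Linked (e x) (e y) := by
  cases h with
  | next p =>
    have := Linked.next (D := D.relabel e) (e x)
    rwa [relabel_next] at this
  | cross c hc => exact Linked.cross (D := D.relabel e) (c.map e) ⟨c, hc, rfl⟩

theorem planar_relabel (D : Diagram P) (e : P ≃ Q) : (D.relabel e).Planar ↔ D.Planar := by
  have hf : Nat.card D.Face = Nat.card (D.relabel e).Face := by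
    refine Nat.card_quot_eq (fun x => (e x.1, x.2)) (fun x => (e.symm x.1, x.2))
      (fun a b h => Quot.sound (h.relabel e)) (fun a b h => Quot.sound ?_) (by simp) (by simp)
    have := h.relabel e.symm
    rwa [relabel_relabel_symm] at this
  have hp : Nat.card D.Piece = Nat.card (D.relabel e).Piece := by
    refine Nat.card_quot_eq e e.symm
      (fun a b h => Quot.sound (h.relabel e)) (fun a b h => Quot.sound ?_) (by simp) (by simp)
    have := h.relabel e.symm
    rwa [relabel_relabel_symm] at this
  have hc : Nat.card (D.relabel e).crossings = Nat.card D.crossings :=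
    Nat.card_image_of_injective (Crossing.map_injective e.injective) _
  rw [Planar, Planar, hf, hp, hc]

/-- Insert an element before `p` into the cycle of `p`. -/
def insertBefore {T : Type*} [DecidableEq T] (rot : Equiv.Perm T) (p : T) :
    Equiv.Perm (Option T) :=
  (Equiv.optionCongr rot).trans (Equiv.swap none (some p))

section insertBefore

variable {T : Type*} [DecidableEq T] (rot : Equiv.Perm T) (p : T)

@[simp] theorem insertBefore_none : insertBefore rot p none = some p := by
  simp [insertBefore]

theorem insertBefore_some (q : T) :
    insertBefore rot p (some q) = if rot q = p then none else some (rot q) := by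
  simp only [insertBefore, Equiv.trans_apply, Equiv.optionCongr_apply, Option.map_some]
  split_ifs with h
  · rw [h, Equiv.swap_apply_right]
  · exact Equiv.swap_apply_of_ne_of_ne (by simp) (by simpa using h)

theorem insertBefore_symm_none : (insertBefore rot p).symm none = some (rot.symm p) := by
  rw [Equiv.symm_apply_eq, insertBefore_some, Equiv.apply_symm_apply, if_pos rfl]

theorem insertBefore_symm_some (q : T) :
    (insertBefore rot p).symm (some q) = if q = p then none else some (rot.symm q) := by
  rw [Equiv.symm_apply_eq]
  split_ifs with h
  · rw [insertBefore_none, h]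
  · rw [insertBefore_some, Equiv.apply_symm_apply, if_neg h]

end insertBefore

variable [DecidableEq P]

/-- The diagram with one more marked point, just before `p`. -/
def markBefore (D : Diagram P) (p : P) : Diagram (Option P) where
  next := insertBefore D.next p
  crossings := Crossing.map some '' D.crossings
  left_ne_right := by
    rintro _ ⟨c, hc, rfl⟩ h
    exact D.left_ne_right c hc (Option.some_injective _ h)
  eq_of_meets := by
    rintro _ ⟨c, hc, rfl⟩ _ ⟨d, hd, rfl⟩ q hq hq'
    rcases q with _ | q
    · rcases hq with h | h <;> cases h
    rw [Crossing.meets_map (Option.some_injective _)] at hq hq'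
    rw [D.eq_of_meets c hc d hd q hq hq']

theorem move_markBefore (D : Diagram P) (p : P) : D.Move (D.markBefore p) := by
  refine Move.mark D _ (D.next.symm p) ?_ ?_ ?_ rfl
  · simp [markBefore, insertBefore_some]
  · simp [markBefore]
  · intro q hq
    have : D.next q ≠ p := fun h => hq (by rw [← h, Equiv.symm_apply_apply])
    simp [markBefore, insertBefore_some, this]

theorem mk_markBefore_none (D : Diagram P) (p : P) (b : Bool) :
    Quot.mk (D.markBefore p).Corner (none, b) =
      Quot.mk (D.markBefore p).Corner (some (D.next.symm p), b) := by
  have h := Corner.pass (D := D.markBefore p) none (by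
    rintro _ ⟨c, hc, rfl⟩ (h | h) <;> cases h) b
  rw [show (D.markBefore p).next.symm none = some (D.next.symm p) from
    insertBefore_symm_none _ _] at h
  exact (Quot.sound h).symm

theorem mk_markBefore_symm_some (D : Diagram P) (p q : P) (b : Bool) :
    Quot.mk (D.markBefore p).Corner ((D.markBefore p).next.symm (some q), b) =
      Quot.mk (D.markBefore p).Corner (some (D.next.symm q), b) := by
  rw [show (D.markBefore p).next.symm (some q) = _ from insertBefore_symm_some _ _ _]
  split_ifs with h
  · rw [h, mk_markBefore_none]
  · rfl

theorem mk_eq_of_markBefore_corner (D : Diagram P) (p q : P) (b : Bool) :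
    Quot.mk D.Corner (((D.markBefore p).next.symm (some q)).getD (D.next.symm p), b) =
      Quot.mk D.Corner (D.next.symm q, b) := by
  rw [show (D.markBefore p).next.symm (some q) = _ from insertBefore_symm_some _ _ _]
  split_ifs with h
  · rw [h]; rfl
  · rfl

/-- The new point only subdivides an arc: its two sides continue those of the arc, so the numbers of
faces, pieces and crossings do not change. -/
theorem planar_markBefore (D : Diagram P) (p : P) : (D.markBefore p).Planar ↔ D.Planar := by
  have hf : Nat.card D.Face = Nat.card (D.markBefore p).Face := by
    refine Nat.card_quot_eq (fun x => (some x.1, x.2))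
      (fun x => (x.1.getD (D.next.symm p), x.2)) ?_ ?_ (fun a => rfl) ?_
    · intro a b h
      cases h with
      | left c hc =>
        have := Quot.sound (Corner.left (D := D.markBefore p) (c.map some) ⟨c, hc, rfl⟩)
        rwa [show (c.map some).left = some c.left from rfl, mk_markBefore_symm_some] at this
      | right c hc =>
        have := Quot.sound (Corner.right (D := D.markBefore p) (c.map some) ⟨c, hc, rfl⟩)
        rwa [show (c.map some).right = some c.right from rfl, mk_markBefore_symm_some] at this
      | top c hc => exact Quot.sound (Corner.top (D := D.markBefore p) (c.map some) ⟨c, hc, rfl⟩)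
      | bottom c hc =>
        have := Quot.sound (Corner.bottom (D := D.markBefore p) (c.map some) ⟨c, hc, rfl⟩)
        rwa [show (c.map some).left = some c.left from rfl, mk_markBefore_symm_some,
          show (c.map some).right = some c.right from rfl, mk_markBefore_symm_some] at this
      | pass q hq b =>
        have := Quot.sound (Corner.pass (D := D.markBefore p) (some q) (by
          rintro _ ⟨c, hc, rfl⟩
          rw [Crossing.meets_map (Option.some_injective _)]
          exact hq c hc) b)
        rwa [mk_markBefore_symm_some] at this
    · intro a b h
      cases h with
      | left c hc =>
        obtain ⟨c, hc, rfl⟩ := hc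
        exact (D.mk_eq_of_markBefore_corner p c.left _).trans (Quot.sound (Corner.left c hc))
      | right c hc =>
        obtain ⟨c, hc, rfl⟩ := hc
        exact (D.mk_eq_of_markBefore_corner p c.right _).trans (Quot.sound (Corner.right c hc))
      | top c hc =>
        obtain ⟨c, hc, rfl⟩ := hc
        exact Quot.sound (Corner.top c hc)
      | bottom c hc =>
        obtain ⟨c, hc, rfl⟩ := hc
        exact (D.mk_eq_of_markBefore_corner p c.left _).trans
          ((Quot.sound (Corner.bottom c hc)).trans
            (D.mk_eq_of_markBefore_corner p c.right _).symm)
      | pass q hq b =>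
        rcases q with _ | q
        · rw [show (D.markBefore p).next.symm none = _ from insertBefore_symm_none _ _]
          rfl
        · refine (D.mk_eq_of_markBefore_corner p q _).trans (Quot.sound (Corner.pass q ?_ b))
          intro c hc h
          exact hq (c.map some) ⟨c, hc, rfl⟩
            ((Crossing.meets_map (Option.some_injective _) c q).2 h)
    · rintro ⟨_ | q, b⟩
      · exact (D.mk_markBefore_none p b).symm
      · rfl
  have hp : Nat.card D.Piece = Nat.card (D.markBefore p).Piece := by
    have hnone : Quot.mk (D.markBefore p).Linked none = Quot.mk (D.markBefore p).Linked (some p) := by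
      have := Linked.next (D := D.markBefore p) none
      rw [show (D.markBefore p).next none = _ from insertBefore_none _ _] at this
      exact Quot.sound this
    refine Nat.card_quot_eq some (fun x => x.getD p) ?_ ?_ (fun a => rfl) ?_
    · intro a b h
      cases h with
      | next =>
        have := Quot.sound (Linked.next (D := D.markBefore p) (some a))
        rw [show (D.markBefore p).next (some a) = _ from insertBefore_some _ _ _] at this
        split_ifs at this with h
        · rw [this, hnone, h]
        · exact this
      | cross c hc =>
        exact Quot.sound (Linked.cross (D := D.markBefore p) (c.map some) ⟨c, hc, rfl⟩)
    · intro a b h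
      cases h with
      | next =>
        rcases a with _ | a
        · rw [show (D.markBefore p).next none = _ from insertBefore_none _ _]; rfl
        · rw [show (D.markBefore p).next (some a) = _ from insertBefore_some _ _ _]
          have := Quot.sound (Linked.next (D := D) a)
          split_ifs with h
          · rw [h] at this; exact this
          · exact this
      | cross c hc =>
        obtain ⟨c, hc, rfl⟩ := hc
        exact Quot.sound (Linked.cross c hc)
    · rintro (_ | q)
      · exact hnone.symm
      · rfl
  have hc : Nat.card (D.markBefore p).crossings = Nat.card D.crossings :=
    Nat.card_image_of_injective (Crossing.map_injective (Option.some_injective _)) _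
  rw [Planar, Planar, hf, hp, hc]

end Diagram

/-! ### Closed braid diagrams and their planarity -/

namespace BraidThree

open Diagram

/-- The permutation of the three positions at a level with the given letter. -/
def levelPerm : Option (Fin 2 × Bool) → Equiv.Perm (Fin 3)
  | some l => Equiv.swap l.1.castSucc l.1.succ
  | none => 1

section Level

variable {T : Type} (rot : Equiv.Perm T) (f : T → Option (Fin 2 × Bool))

/-- The crossing that the letter `l` makes at the level `t`. -/
def levelCrossing (t : T) (l : Fin 2 × Bool) : Crossing (T × Fin 3) :=
  ⟨(t, l.1.castSucc), (t, l.1.succ), if l.2 then 1 else -1⟩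

/-- The closed braid diagram with levels `T` in the cyclic order `rot`, and at most one letter at
each level. -/
def level : Diagram (T × Fin 3) where
  next := Equiv.prodShear rot fun t => levelPerm (f t)
  crossings := {c | ∃ t l, f t = some l ∧ c = levelCrossing t l}
  left_ne_right := by
    rintro _ ⟨t, l, -, rfl⟩ h
    exact (Fin.castSucc_lt_succ (i := l.1)).ne (Prod.ext_iff.1 h).2
  eq_of_meets := by
    rintro _ ⟨t, l, hl, rfl⟩ _ ⟨t', l', hl', rfl⟩ p hp hp'
    have h1 : p.1 = t := by rcases hp with rfl | rfl <;> rfl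
    have h2 : p.1 = t' := by rcases hp' with rfl | rfl <;> rfl
    have ht : t = t' := h1.symm.trans h2
    subst ht
    have hll : l = l' := Option.some.inj (hl.symm.trans hl')
    rw [hll]

theorem closure_eq_level (u : Word) :
    u.closure = level (finRotate (u.length + 1)) fun t => u[(t : ℕ)]? := by
  refine ext' ?_ rfl
  ext p : 1
  change (finRotate (u.length + 1) p.1, _) = (finRotate (u.length + 1) p.1, _)
  congr 1

@[simp] theorem level_next (t : T) (j : Fin 3) :
    (level rot f).next (t, j) = (rot t, levelPerm (f t) j) := rfl

variable {rot f}

theorem levelPerm_castSucc {o : Option (Fin 2 × Bool)} {l : Fin 2 × Bool} (h : o = some l) :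
    levelPerm o l.1.castSucc = l.1.succ := by
  subst h; exact Equiv.swap_apply_left _ _

theorem levelPerm_succ {o : Option (Fin 2 × Bool)} {l : Fin 2 × Bool} (h : o = some l) :
    levelPerm o l.1.succ = l.1.castSucc := by
  subst h; exact Equiv.swap_apply_right _ _

/-- The levels form a single cycle. -/
def IsCyclic (rot : Equiv.Perm T) : Prop := ∀ t₀ t, ∃ n : ℕ, rot^[n] t₀ = t

/-- The first level from `t` on with the property `p`. -/
noncomputable def firstLevel (p : T → Prop) (h : ∀ t, ∃ n : ℕ, p (rot^[n] t)) (t : T) : T :=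
  open Classical in rot^[Nat.find (h t)] t

section firstLevel

variable {p : T → Prop} (h : ∀ t, ∃ n : ℕ, p (rot^[n] t))

theorem firstLevel_spec (t : T) : p (firstLevel p h t) := by
  classical
  exact Nat.find_spec (h t)

theorem firstLevel_of_mem {t : T} (ht : p t) : firstLevel p h t = t := by
  classical
  have : Nat.find (h t) = 0 := (Nat.find_eq_zero _).2 ht
  rw [firstLevel, this]
  rfl

theorem firstLevel_of_not_mem {t : T} (ht : ¬ p t) :
    firstLevel p h t = firstLevel p h (rot t) := by
  classical
  have h1 : Nat.find (h t) = Nat.find (h (rot t)) + 1 :=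
    Nat.find_comp_succ (h t) (h (rot t)) ht
  rw [firstLevel, h1, firstLevel]
  rfl

theorem eq_firstLevel {γ : Type*} (q : T → γ) (hq : ∀ t, ¬ p t → q t = q (rot t)) (t : T) :
    q t = q (firstLevel p h t) := by
  obtain ⟨n, hn⟩ := h t
  induction n generalizing t with
  | zero => rw [firstLevel_of_mem h (t := t) hn]
  | succ n ih =>
    by_cases ht : p t
    · rw [firstLevel_of_mem h ht]
    · rw [firstLevel_of_not_mem h ht, hq t ht]
      exact ih _ hn

end firstLevel

theorem IsCyclic.eq {γ : Type*} (hrot : IsCyclic rot) (q : T → γ) (hq : ∀ t, q t = q (rot t))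
    (t t' : T) : q t = q t' := by
  obtain ⟨n, rfl⟩ := hrot t t'
  induction n generalizing t with
  | zero => rfl
  | succ n ih => rw [hq t, ih]; rfl

variable (f) in
/-- No letter of the braid is a power of the generator number `g`. -/
def Avoids (g : Fin 2) : Prop := ∀ t s, f t ≠ some (g, s)

/-- The gap between two strings which is adjacent to a side of a string, if any. -/
def gapOf : Fin 3 → Bool → Option (Fin 2)
  | 0, true => none
  | 0, false => some 0
  | 1, true => some 0
  | 1, false => some 1
  | 2, true => some 1
  | 2, false => none

variable (f) in
/-- The letter at level `t` is a power of the generator number `g`. -/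
def HasLetter (g : Fin 2) (t : T) : Prop := ∃ s, f t = some (g, s)

theorem exists_iterate_of_not_avoids (hrot : IsCyclic rot) {g : Fin 2} (hg : ¬ Avoids f g)
    (t : T) : ∃ n : ℕ, HasLetter f g (rot^[n] t) := by
  simp only [Avoids, not_forall, not_not] at hg
  obtain ⟨t', s, h⟩ := hg
  obtain ⟨n, rfl⟩ := hrot t t'
  exact ⟨n, s, h⟩

/-- The names of the faces of a closed braid diagram: the two outer faces, for each crossing the
face below it, and the two sides of each gap without crossings. -/
abbrev FaceName (f : T → Option (Fin 2 × Bool)) : Type :=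
  Bool ⊕ {t // f t ≠ none} ⊕ {g // Avoids f g} × Bool

open Classical in
/-- The name of the face at the side `b` of the gap `g` just below level `t`. -/
noncomputable def gapFace (hrot : IsCyclic rot) (g : Fin 2) (t : T) (b : Bool) :
    FaceName f :=
  if h : Avoids f g then .inr (.inr (⟨g, h⟩, b)) else
    .inr (.inl ⟨firstLevel _ (exists_iterate_of_not_avoids hrot h) t, by
      obtain ⟨s, hs⟩ := firstLevel_spec (exists_iterate_of_not_avoids hrot h) t
      rw [hs]
      exact Option.some_ne_none _⟩)

theorem gapFace_rot (hrot : IsCyclic rot) {g : Fin 2} {t : T} (h : ∀ s, f t ≠ some (g, s))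
    (b : Bool) : gapFace (f := f) hrot g (rot t) b = gapFace hrot g t b := by
  unfold gapFace
  split_ifs with hg
  · rfl
  · congr 3
    exact (firstLevel_of_not_mem _ (fun ⟨s, hs⟩ => h s hs)).symm

theorem gapFace_bool (hrot : IsCyclic rot) {g : Fin 2} (h : ¬ Avoids f g) (t : T)
    (b b' : Bool) : gapFace (f := f) hrot g t b = gapFace hrot g t b' := by
  simp only [gapFace, dif_neg h]

/-- The name of the face at the side `b` of the arc that ends at `q`. -/
noncomputable def sideFace (hrot : IsCyclic rot) (q : T × Fin 3) (b : Bool) : FaceName f :=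
  match gapOf q.2 b with
  | none => .inl b
  | some g => gapFace hrot g q.1 b

theorem sideFace_rot (hrot : IsCyclic rot) {t : T} {j : Fin 3} {b : Bool}
    (h : ∀ g, gapOf j b = some g → ∀ s, f t ≠ some (g, s)) :
    sideFace (f := f) hrot (rot t, j) b = sideFace hrot (t, j) b := by
  unfold sideFace
  cases hg : gapOf j b with
  | none => simp
  | some g => simpa [hg] using gapFace_rot hrot (h g hg) b

theorem sideFace_gap (hrot : IsCyclic rot) {g : Fin 2} (h : ¬ Avoids f g) (t : T) :
    sideFace (f := f) hrot (t, g.castSucc) false = sideFace hrot (t, g.succ) true := by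
  have h1 : gapOf g.castSucc false = some g := by fin_cases g <;> rfl
  have h2 : gapOf g.succ true = some g := by fin_cases g <;> rfl
  simp only [sideFace, h1, h2]
  exact gapFace_bool hrot h t _ _

theorem gapOf_castSucc_true_ne (g : Fin 2) : gapOf g.castSucc true ≠ some g := by
  fin_cases g <;> decide

theorem gapOf_succ_false_ne (g : Fin 2) : gapOf g.succ false ≠ some g := by
  fin_cases g <;> decide

theorem gapOf_ne_of_ne {g : Fin 2} {j : Fin 3} (h1 : j ≠ g.castSucc) (h2 : j ≠ g.succ)
    (b : Bool) : gapOf j b ≠ some g := by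
  revert g j b; decide

theorem levelPerm_of_ne {l : Fin 2 × Bool} {j : Fin 3} (h1 : j ≠ l.1.castSucc)
    (h2 : j ≠ l.1.succ) : levelPerm (some l) j = j :=
  Equiv.swap_apply_of_ne_of_ne h1 h2

theorem levelPerm_of_pass {t : T} {j : Fin 3}
    (h : ∀ c ∈ (level rot f).crossings, ¬ c.Meets (t, j)) :
    levelPerm (f t) j = j ∧ ∀ b g, gapOf j b = some g → ∀ s, f t ≠ some (g, s) := by
  cases hf : f t with
  | none => exact ⟨rfl, by simp⟩
  | some l =>
    have hl := h (levelCrossing t l) ⟨t, l, hf, rfl⟩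
    have h1 : j ≠ l.1.castSucc := fun e => hl (Or.inl (Prod.ext rfl e))
    have h2 : j ≠ l.1.succ := fun e => hl (Or.inr (Prod.ext rfl e))
    refine ⟨levelPerm_of_ne h1 h2, ?_⟩
    rintro b g hg s hs
    cases hs
    exact gapOf_ne_of_ne h1 h2 b hg

theorem not_avoids {t : T} {l : Fin 2 × Bool} (h : f t = some l) : ¬ Avoids f l.1 :=
  fun hg => hg t l.2 h

theorem ne_of_gap {t : T} {l : Fin 2 × Bool} (h : f t = some l) {j : Fin 3} {b : Bool}
    (hj : gapOf j b ≠ some l.1) : ∀ g, gapOf j b = some g → ∀ s, f t ≠ some (g, s) := by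
  rintro g hg s hs
  rw [hs] at h
  cases h
  exact hj hg

theorem sideFace_corner (hrot : IsCyclic rot) {x y : (T × Fin 3) × Bool}
    (h : (level rot f).Corner x y) :
    sideFace (f := f) hrot ((level rot f).next x.1) x.2 =
      sideFace hrot ((level rot f).next y.1) y.2 := by
  cases h with
  | left c hc =>
    obtain ⟨t, l, hl, rfl⟩ := hc
    simp only [Equiv.apply_symm_apply, levelCrossing, level_next, levelPerm_succ hl]
    exact (sideFace_rot hrot (ne_of_gap hl (gapOf_castSucc_true_ne _))).symm
  | right c hc =>
    obtain ⟨t, l, hl, rfl⟩ := hc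
    simp only [Equiv.apply_symm_apply, levelCrossing, level_next, levelPerm_castSucc hl]
    exact (sideFace_rot hrot (ne_of_gap hl (gapOf_succ_false_ne _))).symm
  | top c hc =>
    obtain ⟨t, l, hl, rfl⟩ := hc
    simp only [levelCrossing, level_next, levelPerm_castSucc hl, levelPerm_succ hl]
    exact sideFace_gap hrot (not_avoids hl) _
  | bottom c hc =>
    obtain ⟨t, l, hl, rfl⟩ := hc
    simp only [Equiv.apply_symm_apply, levelCrossing]
    exact sideFace_gap hrot (not_avoids hl) _
  | pass p hp b =>
    obtain ⟨t, j⟩ := p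
    obtain ⟨h1, h2⟩ := levelPerm_of_pass hp
    simp only [Equiv.apply_symm_apply, level_next, h1]
    exact (sideFace_rot hrot (h2 b)).symm

variable (rot f) in
/-- The face at the side `b` of the arc that ends at `q`. -/
def faceBelow (q : T × Fin 3) (b : Bool) : (level rot f).Face :=
  Quot.mk _ ((level rot f).next.symm q, b)

theorem mk_eq_faceBelow (p : T × Fin 3) (b : Bool) :
    Quot.mk (level rot f).Corner (p, b) = faceBelow rot f ((level rot f).next p) b := by
  rw [faceBelow, Equiv.symm_apply_apply]

/-- A face beside position `j` is closed off only by a crossing in its own gap. If the string at `j`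
crosses away on the other side, the left or right corner of that crossing continues the face. -/
theorem faceBelow_rot {t : T} {j : Fin 3} {b : Bool}
    (h : ∀ g, gapOf j b = some g → ∀ s, f t ≠ some (g, s)) :
    faceBelow rot f (t, j) b = faceBelow rot f (rot t, j) b := by
  by_cases hp : ∀ c ∈ (level rot f).crossings, ¬ c.Meets (t, j)
  · have h1 := Quot.sound (Corner.pass (D := level rot f) (t, j) hp b)
    rw [mk_eq_faceBelow (t, j), level_next, (levelPerm_of_pass hp).1] at h1
    exact h1
  · push Not at hp
    obtain ⟨_, ⟨t', l, hl, rfl⟩, hm⟩ := hp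
    have h1 := Quot.sound (Corner.left (D := level rot f) _ ⟨t', l, hl, rfl⟩)
    have h2 := Quot.sound (Corner.right (D := level rot f) _ ⟨t', l, hl, rfl⟩)
    simp only [levelCrossing] at h1 h2
    rw [mk_eq_faceBelow (_, Fin.succ _), level_next, levelPerm_succ hl] at h1
    rw [mk_eq_faceBelow (_, Fin.castSucc _), level_next, levelPerm_castSucc hl] at h2
    have key : ∀ g : Fin 2, gapOf g.castSucc false = some g ∧ gapOf g.succ true = some g := by
      decide
    rcases hm with hm | hm <;> cases hm <;> cases b
    · exact absurd hl (h _ (key _).1 _)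
    · exact h1
    · exact h2
    · exact absurd hl (h _ (key _).2 _)

theorem faceBelow_gap {t : T} {l : Fin 2 × Bool} (h : f t = some l) :
    faceBelow rot f (t, l.1.castSucc) false = faceBelow rot f (t, l.1.succ) true :=
  Quot.sound (Corner.bottom (D := level rot f) _ ⟨t, l, h, rfl⟩)

/-- The faces of a closed braid diagram. -/
noncomputable def faceEquiv (hrot : IsCyclic rot) (t₀ : T) :
    (level rot f).Face ≃ FaceName f where
  toFun := Quot.lift (fun x => sideFace hrot ((level rot f).next x.1) x.2)
    fun _ _ => sideFace_corner hrot
  invFun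
    | .inl true => faceBelow rot f (t₀, 0) true
    | .inl false => faceBelow rot f (t₀, 2) false
    | .inr (.inl t) =>
      faceBelow rot f (t.1, ((f t.1).get (Option.isSome_iff_ne_none.2 t.2)).1.castSucc) false
    | .inr (.inr (g, true)) => faceBelow rot f (t₀, g.1.succ) true
    | .inr (.inr (g, false)) => faceBelow rot f (t₀, g.1.castSucc) false
  left_inv := by
    intro x
    induction x using Quot.inductionOn with
    | h x =>
    obtain ⟨p, b⟩ := x
    rw [mk_eq_faceBelow]
    generalize hq : (level rot f).next p = q
    obtain ⟨t, j⟩ := q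
    simp only [faceBelow, Equiv.apply_symm_apply]
    change _ = faceBelow rot f (t, j) b
    unfold sideFace
    have hall : ∀ {j b}, gapOf j b = none → faceBelow rot f (t₀, j) b = faceBelow rot f (t, j) b :=
      fun {j b} hg => hrot.eq (fun t => faceBelow rot f (t, j) b)
        (fun t => faceBelow_rot (by simp [hg])) t₀ t
    have hgap : ∀ (g : Fin 2) (j : Fin 3) (b : Bool), gapOf j b = some g →
        ((j = g.castSucc ∧ b = false) ∨ (j = g.succ ∧ b = true)) := by decide
    have hnone : ∀ (j : Fin 3) (b : Bool), gapOf j b = none →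
        ((j = 0 ∧ b = true) ∨ (j = 2 ∧ b = false)) := by decide
    cases hg : gapOf j b with
    | none =>
      rcases hnone j b hg with ⟨rfl, rfl⟩ | ⟨rfl, rfl⟩
      · exact hall rfl
      · exact hall rfl
    | some g =>
      simp only [gapFace]
      by_cases ha : Avoids f g
      · simp only [dif_pos ha]
        have hv : faceBelow rot f (t₀, j) b = faceBelow rot f (t, j) b :=
          hrot.eq (fun t => faceBelow rot f (t, j) b) (fun t => faceBelow_rot (by
            intro g' hg' s
            rw [hg] at hg'
            cases hg'
            exact ha t s)) t₀ t
        rcases hgap g j b hg with ⟨rfl, rfl⟩ | ⟨rfl, rfl⟩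
        · exact hv
        · exact hv
      · simp only [dif_neg ha]
        have hx := exists_iterate_of_not_avoids hrot ha
        -- Inside a gap with crossings, the face runs upwards to the first of them, which gives it
        -- its name.
        have hv := eq_firstLevel hx (fun t => faceBelow rot f (t, j) b) (fun t ht =>
          faceBelow_rot (by
            intro g' hg' s
            rw [hg] at hg'
            cases hg'
            exact fun e => ht ⟨s, e⟩)) t
        obtain ⟨s, hs⟩ := firstLevel_spec hx t
        change faceBelow rot f _ false = faceBelow rot f (t, j) b
        rw [hv]
        simp only [hs, Option.get_some]
        rcases hgap g j b hg with ⟨rfl, rfl⟩ | ⟨rfl, rfl⟩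
        · rfl
        · exact faceBelow_gap hs
  right_inv := by
    have hb : ∀ (q : T × Fin 3) (b : Bool),
        Quot.lift (fun x : (T × Fin 3) × Bool =>
          sideFace (f := f) hrot ((level rot f).next x.1) x.2)
          (fun _ _ => sideFace_corner hrot) (faceBelow rot f q b) = sideFace hrot q b := by
      intro q b
      simp [faceBelow]
    rintro ((_ | _) | ⟨t, ht⟩ | ⟨⟨g, hg⟩, (_ | _)⟩)
    · exact hb _ _
    · exact hb _ _
    · refine (hb _ _).trans ?_
      obtain ⟨⟨i, s⟩, hl⟩ := Option.ne_none_iff_exists'.1 ht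
      have h1 : gapOf i.castSucc false = some i := by fin_cases i <;> rfl
      simp only [hl, Option.get_some, sideFace, h1, gapFace, dif_neg (not_avoids hl)]
      congr 3
      exact firstLevel_of_mem _ ⟨s, hl⟩
    · refine (hb _ _).trans ?_
      have h1 : gapOf g.castSucc false = some g := by fin_cases g <;> rfl
      simp only [sideFace, h1, gapFace, dif_pos hg]
    · refine (hb _ _).trans ?_
      have h1 : gapOf g.succ true = some g := by fin_cases g <;> rfl
      simp only [sideFace, h1, gapFace, dif_pos hg]

variable (f) in
open Classical in
/-- The piece of the string position `j`, named by the gap to its left. -/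
noncomputable def pieceName : Fin 3 → Option {g // Avoids f g}
  | 0 => none
  | 1 => if h : Avoids f 0 then some ⟨0, h⟩ else none
  | 2 => if h : Avoids f 1 then some ⟨1, h⟩ else
      if h : Avoids f 0 then some ⟨0, h⟩ else none

theorem pieceName_castSucc {g : Fin 2} (h : ¬ Avoids f g) :
    pieceName f g.castSucc = pieceName f g.succ := by
  fin_cases g
  · change ¬ Avoids f 0 at h
    change pieceName f 0 = pieceName f 1
    simp [pieceName, h]
  · change ¬ Avoids f 1 at h
    change pieceName f 1 = pieceName f 2
    simp [pieceName, h]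

theorem pieceName_succ {g : Fin 2} (h : Avoids f g) : pieceName f g.succ = some ⟨g, h⟩ := by
  fin_cases g
  · exact dif_pos h
  · exact dif_pos h

theorem piece_castSucc {t : T} {l : Fin 2 × Bool} (h : f t = some l) :
    Quot.mk (level rot f).Linked (t, l.1.castSucc) = Quot.mk (level rot f).Linked (t, l.1.succ) :=
  Quot.sound (Linked.cross (D := level rot f) (levelCrossing t l) ⟨t, l, h, rfl⟩)

/-- What is followed is the position, not the string: where the string leaves position `j`, the
crossing links it to the one that arrives there. -/
theorem piece_rot (t : T) (j : Fin 3) :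
    Quot.mk (level rot f).Linked (t, j) = Quot.mk (level rot f).Linked (rot t, j) := by
  have hn : ∀ j, Quot.mk (level rot f).Linked (t, j) =
      Quot.mk (level rot f).Linked (rot t, levelPerm (f t) j) := fun j =>
    Quot.sound (Linked.next (D := level rot f) (t, j))
  cases hf : f t with
  | none => rw [hn, hf]; rfl
  | some l =>
    by_cases h1 : j = l.1.castSucc
    · rw [h1, piece_castSucc hf, hn, levelPerm_succ hf]
    by_cases h2 : j = l.1.succ
    · rw [h2, ← piece_castSucc hf, hn, levelPerm_castSucc hf]
    rw [hn, hf, levelPerm_of_ne h1 h2]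

/-- The pieces of a closed braid diagram. -/
noncomputable def pieceEquiv (hrot : IsCyclic rot) (t₀ : T) :
    (level rot f).Piece ≃ Option {g // Avoids f g} where
  toFun := Quot.lift (fun p => pieceName f p.2) (by
    intro x y h
    cases h with
    | next =>
      obtain ⟨t, j⟩ := x
      simp only [level_next]
      cases hf : f t with
      | none => rfl
      | some l =>
        have := pieceName_castSucc (not_avoids hf)
        by_cases h1 : j = l.1.castSucc
        · rw [h1, levelPerm_castSucc rfl, this]
        by_cases h2 : j = l.1.succ
        · rw [h2, levelPerm_succ rfl, this]
        rw [levelPerm_of_ne h1 h2]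
    | cross c hc =>
      obtain ⟨t, l, hl, rfl⟩ := hc
      exact pieceName_castSucc (not_avoids hl))
  invFun
    | none => Quot.mk _ (t₀, 0)
    | some g => Quot.mk _ (t₀, g.1.succ)
  left_inv := by
    intro x
    induction x using Quot.inductionOn with
    | h x =>
    obtain ⟨t, j⟩ := x
    have hall : ∀ t' j, Quot.mk (level rot f).Linked (t, j) =
        Quot.mk (level rot f).Linked (t', j) := fun t' j =>
      hrot.eq (fun t => Quot.mk (level rot f).Linked (t, j)) (fun t => piece_rot t j) t t'
    have hstep : ∀ g : Fin 2, ¬ Avoids f g →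
        Quot.mk (level rot f).Linked (t₀, g.castSucc) =
          Quot.mk (level rot f).Linked (t₀, g.succ) := by
      intro g hg
      simp only [Avoids, not_forall, not_not] at hg
      obtain ⟨t', s, h⟩ := hg
      have hall' : ∀ j, Quot.mk (level rot f).Linked (t₀, j) =
          Quot.mk (level rot f).Linked (t', j) := fun j => (hall t₀ j).symm.trans (hall t' j)
      rw [hall', hall']
      exact piece_castSucc h
    rw [hall t₀ j]
    have s0 := hstep 0
    have s1 := hstep 1
    change ¬ _ → Quot.mk (level rot f).Linked (t₀, 0) = Quot.mk (level rot f).Linked (t₀, 1) at s0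
    change ¬ _ → Quot.mk (level rot f).Linked (t₀, 1) = Quot.mk (level rot f).Linked (t₀, 2) at s1
    fin_cases j
    · rfl
    · by_cases h0 : Avoids f 0
      · simp only [pieceName, dif_pos h0]; rfl
      · simp only [pieceName, dif_neg h0]; exact s0 h0
    · by_cases h1 : Avoids f 1
      · simp only [pieceName, dif_pos h1]; rfl
      · by_cases h0 : Avoids f 0
        · simp only [pieceName, dif_neg h1, dif_pos h0]; exact s1 h1
        · simp only [pieceName, dif_neg h1, dif_neg h0]; exact (s0 h0).trans (s1 h1)
  right_inv := by
    rintro (_ | ⟨g, hg⟩)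
    · rfl
    · exact pieceName_succ hg

/-- The crossings of a closed braid diagram. -/
noncomputable def crossingEquiv : {t // f t ≠ none} ≃ (level rot f).crossings :=
  Equiv.ofBijective (fun t => ⟨levelCrossing t.1 ((f t.1).get (Option.isSome_iff_ne_none.2 t.2)),
    t.1, _, (Option.some_get _).symm, rfl⟩) (by
    constructor
    · rintro ⟨t, ht⟩ ⟨t', ht'⟩ h
      have := congrArg (fun c => c.1.left.1) h
      exact Subtype.ext this
    · rintro ⟨_, t, l, hl, rfl⟩
      refine ⟨⟨t, by simp [hl]⟩, Subtype.ext ?_⟩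
      simp [hl])

/-- Closed braid diagrams are planar. -/
theorem planar_level [Finite T] [Nonempty T] (hrot : IsCyclic rot) : (level rot f).Planar := by
  have t₀ : T := Classical.arbitrary T
  have h1 := Nat.card_congr (faceEquiv (f := f) hrot t₀)
  have h2 := Nat.card_congr (pieceEquiv (f := f) hrot t₀)
  have h3 := Nat.card_congr (crossingEquiv (rot := rot) (f := f))
  rw [Nat.card_sum, Nat.card_sum, Nat.card_prod, Nat.card_eq_fintype_card (α := Bool),
    Fintype.card_bool] at h1
  rw [Finite.card_option] at h2
  -- With `m` crossing-free gaps there are `2 + #crossings + 2 m` faces and `m + 1` pieces.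
  rw [Planar, h1, h2, ← h3]
  ring

end Level

end BraidThree

/-! ### Empty levels, cancellation and skein triples of closed braids -/

namespace Diagram

variable {P Q : Type}

theorem relabel_eq {D : Diagram P} {D' : Diagram Q} (e : P ≃ Q)
    (hn : ∀ p, D'.next (e p) = e (D.next p))
    (hc : D'.crossings = Crossing.map e '' D.crossings) : D.relabel e = D' := by
  refine ext' (Equiv.ext fun q => ?_) hc.symm
  obtain ⟨p, rfl⟩ := e.surjective q
  rw [relabel_next, hn]

end Diagram

namespace BraidThree

open Diagram

section Level

variable {T T' : Type} {rot : Equiv.Perm T} {rot' : Equiv.Perm T'}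
  {f : T → Option (Fin 2 × Bool)} {f' : T' → Option (Fin 2 × Bool)}

theorem relabel_level (e : T ≃ T') (hrot : ∀ t, rot' (e t) = e (rot t))
    (hf : ∀ t, f' (e t) = f t) :
    (level rot f).relabel (e.prodCongr (Equiv.refl (Fin 3))) = level rot' f' := by
  refine relabel_eq _ ?_ ?_
  · rintro ⟨t, j⟩
    simp [hrot, hf]
  · ext c
    constructor
    · rintro ⟨t, l, hl, rfl⟩
      obtain ⟨t, rfl⟩ := e.surjective t
      exact ⟨levelCrossing t l, ⟨t, l, by rw [← hf, hl], rfl⟩, rfl⟩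
    · rintro ⟨_, ⟨t, l, hl, rfl⟩, rfl⟩
      exact ⟨e t, l, by rw [hf, hl], rfl⟩

theorem IsCyclic.of_equiv (e : T ≃ T') (hrot : ∀ t, rot' (e t) = e (rot t)) (h : IsCyclic rot) :
    IsCyclic rot' := by
  intro t t'
  obtain ⟨n, hn⟩ := h (e.symm t) (e.symm t')
  refine ⟨n, ?_⟩
  have : ∀ (n : ℕ) (x : T), rot'^[n] (e x) = e (rot^[n] x) := by
    intro n
    induction n with
    | zero => intro x; rfl
    | succ n ih => intro x; rw [Function.iterate_succ_apply, hrot, ih]; rfl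
  have h2 := this n (e.symm t)
  rwa [hn, Equiv.apply_symm_apply, Equiv.apply_symm_apply] at h2

theorem isCyclic_finRotate (n : ℕ) : IsCyclic (finRotate n) := by
  cases n with
  | zero => exact fun t => t.elim0
  | succ n =>
    intro t t'
    have key : ∀ (k : ℕ) (x : Fin (n + 1)),
        ((finRotate (n + 1))^[k] x : ℕ) = (x + k) % (n + 1) := by
      intro k
      induction k with
      | zero => intro x; simp [Nat.mod_eq_of_lt x.2]
      | succ k ih =>
        intro x
        rw [Function.iterate_succ_apply, ih, finRotate_apply, Fin.val_add, Fin.val_one',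
          Nat.add_mod_mod, Nat.mod_add_mod]
        congr 1
        ring
    refine ⟨t' + (n + 1 - t), Fin.ext ?_⟩
    have h1 := t.2
    rw [key, show (t : ℕ) + (t' + (n + 1 - t)) = t' + (n + 1) by omega, Nat.add_mod_right,
      Nat.mod_eq_of_lt t'.2]

theorem levelCrossing_eq_iff {t t' : T} {l l' : Fin 2 × Bool} (h : f t = some l)
    (h' : f t' = some l') : levelCrossing t l = levelCrossing t' l' ↔ t = t' := by
  constructor
  · intro e
    exact congrArg (fun c : Crossing (T × Fin 3) => c.left.1) e
  · rintro rfl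
    rw [h] at h'
    cases h'
    rfl

variable [DecidableEq T]

/-- The position of the three new points marked before a level. -/
def insertLevelEquiv (T : Type) :
    Option (Option (Option (T × Fin 3))) ≃ Option T × Fin 3 where
  toFun
    | none => (none, 2)
    | some none => (none, 1)
    | some (some none) => (none, 0)
    | some (some (some p)) => (some p.1, p.2)
  invFun
    | (none, 2) => none
    | (none, 1) => some none
    | (none, 0) => some (some none)
    | (some t, j) => some (some (some (t, j)))
  left_inv := by rintro (_ | _ | _ | _) <;> rfl
  right_inv := by
    rintro ⟨_ | t, j⟩
    · fin_cases j <;> rfl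
    · rfl

theorem insert_level (t₁ : T) :
    ((((level rot f).markBefore (t₁, 0)).markBefore (some (t₁, 1))).markBefore
      (some (some (t₁, 2)))).relabel (insertLevelEquiv T) =
      level (insertBefore rot t₁) (fun o => o.elim none f) := by
  refine relabel_eq _ ?_ ?_
  · rintro (_ | _ | _ | ⟨t, j⟩)
    · simp [insertLevelEquiv, markBefore, levelPerm]
    · simp [insertLevelEquiv, markBefore, levelPerm, insertBefore_some]
    · simp [insertLevelEquiv, markBefore, levelPerm, insertBefore_some]
    · simp only [insertLevelEquiv, markBefore, insertBefore_some, level_next, Equiv.coe_fn_mk,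
        Option.elim_some]
      obtain ⟨k, hk⟩ : ∃ k, levelPerm (f t) j = k := ⟨_, rfl⟩
      simp only [hk]
      clear hk
      by_cases h : rot t = t₁
      · fin_cases k <;> simp [h]
      · simp [h]
  · ext c
    constructor
    · rintro ⟨_ | t, l, hl, rfl⟩
      · cases hl
      · exact ⟨_, ⟨_, ⟨_, ⟨_, ⟨t, l, hl, rfl⟩, rfl⟩, rfl⟩, rfl⟩, rfl⟩
    · rintro ⟨_, ⟨_, ⟨_, ⟨_, ⟨t, l, hl, rfl⟩, rfl⟩, rfl⟩, rfl⟩, rfl⟩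
      exact ⟨some t, l, hl, rfl⟩

/-- Exchange the strings `i` and `i + 1` at one level. -/
def swapAt (t : T) (i : Fin 2) : T × Fin 3 ≃ T × Fin 3 :=
  Equiv.prodShear (Equiv.refl T) fun t' => if t' = t then Equiv.swap i.castSucc i.succ else 1

theorem swapAt_self (t : T) (i : Fin 2) (j : Fin 3) :
    swapAt t i (t, j) = (t, Equiv.swap i.castSucc i.succ j) := by
  simp [swapAt]

theorem swapAt_of_ne {t t' : T} (h : t' ≠ t) (i : Fin 2) (j : Fin 3) :
    swapAt t i (t', j) = (t', j) := by
  simp [swapAt, h]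

/-- Deleting the two crossings keeps `next`, so the two strings still trade positions twice.
Exchanging their names at the level in between makes both levels empty. -/
theorem swapAt_next {t : T} {i : Fin 2} {b b' : Bool} (ht : rot t ≠ t) (h0 : f t = some (i, b))
    (h1 : f (rot t) = some (i, b')) :
    ((level rot (Function.update (Function.update f t none) (rot t) none)).relabel
      (swapAt (rot t) i)).next = (level rot f).next := by
  refine Equiv.ext fun q => ?_
  obtain ⟨⟨t', j⟩, rfl⟩ := (swapAt (rot t) i).surjective q
  rw [relabel_next, level_next]
  by_cases hr : t' = rot t
  · subst hr
    have h2 : rot (rot t) ≠ rot t := fun h => ht (rot.injective h)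
    rw [swapAt_self, level_next, h1, Function.update_self]
    simp [levelPerm, swapAt_of_ne h2]
  · rw [swapAt_of_ne hr, level_next, Function.update_of_ne hr]
    by_cases h : t' = t
    · subst h
      rw [Function.update_self, h0]
      simp [levelPerm, swapAt_self]
    · have h2 : rot t' ≠ rot t := fun h' => h (rot.injective h')
      rw [Function.update_of_ne h, swapAt_of_ne h2]

theorem swapAt_crossings {t : T} {i : Fin 2} {b b' : Bool} (h0 : f t = some (i, b))
    (h1 : f (rot t) = some (i, b')) :
    ((level rot (Function.update (Function.update f t none) (rot t) none)).relabel
      (swapAt (rot t) i)).crossings =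
      (level rot f).crossings \ {levelCrossing t (i, b), levelCrossing (rot t) (i, b')} := by
  have hmap : ∀ t' l, t' ≠ rot t →
      (levelCrossing t' l).map (swapAt (rot t) i) = levelCrossing t' l := by
    intro t' l h
    simp [levelCrossing, Crossing.map, swapAt_of_ne h]
  ext c
  constructor
  · rintro ⟨_, ⟨t', l, hl, rfl⟩, rfl⟩
    have hr : t' ≠ rot t := by
      rintro rfl
      simp at hl
    rw [Function.update_of_ne hr] at hl
    have ht : t' ≠ t := by
      rintro rfl
      simp at hl
    rw [Function.update_of_ne ht] at hl
    rw [hmap _ _ hr]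
    refine ⟨⟨t', l, hl, rfl⟩, ?_⟩
    rintro (h | h)
    · exact ht ((levelCrossing_eq_iff hl h0).1 h)
    · exact hr ((levelCrossing_eq_iff hl h1).1 h)
  · rintro ⟨⟨t', l, hl, rfl⟩, hn⟩
    have ht : t' ≠ t := fun h => hn (Or.inl ((levelCrossing_eq_iff hl h0).2 h))
    have hr : t' ≠ rot t := fun h => hn (Or.inr ((levelCrossing_eq_iff hl h1).2 h))
    refine ⟨levelCrossing t' l, ⟨t', l, ?_, rfl⟩, hmap _ _ hr⟩
    rw [Function.update_of_ne hr, Function.update_of_ne ht, hl]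

theorem move_cancel {t : T} {i : Fin 2} {b : Bool} (ht : rot t ≠ t) (h0 : f t = some (i, b))
    (h1 : f (rot t) = some (i, !b)) :
    (level rot f).Move
      ((level rot (Function.update (Function.update f t none) (rot t) none)).relabel
        (swapAt (rot t) i)) := by
  refine Move.reidemeister2 _ _ (levelCrossing t (i, b)) (levelCrossing (rot t) (i, !b))
    ⟨t, _, h0, rfl⟩ ⟨rot t, _, h1, rfl⟩ ?_ ?_ (Or.inl ?_) (swapAt_next ht h0 h1)
    (swapAt_crossings h0 h1)
  · cases b <;> simp [levelCrossing]
  · cases b <;> simp [levelCrossing, Crossing.upper, h0, levelPerm]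
  · cases b <;> simp [levelCrossing, Crossing.lower, h0, levelPerm]

/-- Smoothing a braid crossing along the orientation keeps every string in its position, that is, it
empties the level. -/
theorem skeinTriple_level (t : T) (i : Fin 2) :
    SkeinTriple (level rot (Function.update f t (some (i, true))))
      (level rot (Function.update f t (some (i, false)))) (level rot (Function.update f t none)) := by
  have hne : ∀ t' l s, t' ≠ t → levelCrossing t' l ≠ levelCrossing t (i, s) := by
    intro t' l s h e
    exact h (congrArg (fun c : Crossing (T × Fin 3) => c.left.1) e)
  refine ⟨levelCrossing t (i, true), ⟨t, _, Function.update_self .., rfl⟩, rfl, ?_, ?_, ?_, ?_,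
    ?_, ?_⟩
  · refine Equiv.ext ?_
    rintro ⟨t', j⟩
    by_cases h : t' = t
    · subst h; simp [levelPerm]
    · simp [h]
  · ext c
    constructor
    · rintro ⟨t', l, hl, rfl⟩
      by_cases h : t' = t
      · subst h
        rw [Function.update_self] at hl
        cases hl
        exact Or.inl rfl
      · rw [Function.update_of_ne h] at hl
        exact Or.inr ⟨⟨t', l, by rw [Function.update_of_ne h, hl], rfl⟩, hne _ _ _ h⟩
    · rintro (rfl | ⟨⟨t', l, hl, rfl⟩, hn⟩)
      · exact ⟨t, (i, false), Function.update_self .., rfl⟩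
      · by_cases h : t' = t
        · subst h
          rw [Function.update_self] at hl
          cases hl
          exact absurd rfl hn
        · rw [Function.update_of_ne h] at hl
          exact ⟨t', l, by rw [Function.update_of_ne h, hl], rfl⟩
  · simp [levelCrossing, levelPerm]
  · simp [levelCrossing, levelPerm]
  · rintro ⟨t', j⟩ hm
    by_cases h : t' = t
    · subst h
      have h1 : j ≠ i.castSucc := fun e => hm (Or.inl (Prod.ext rfl e))
      have h2 : j ≠ i.succ := fun e => hm (Or.inr (Prod.ext rfl e))
      rw [level_next, level_next, Function.update_self, Function.update_self,
        levelPerm_of_ne h1 h2]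
      rfl
    · simp [h]
  · ext c
    constructor
    · rintro ⟨t', l, hl, rfl⟩
      have h : t' ≠ t := by
        rintro rfl
        simp at hl
      rw [Function.update_of_ne h] at hl
      exact ⟨⟨t', l, by rw [Function.update_of_ne h, hl], rfl⟩, hne _ _ _ h⟩
    · rintro ⟨⟨t', l, hl, rfl⟩, hn⟩
      by_cases h : t' = t
      · subst h
        rw [Function.update_self] at hl
        cases hl
        exact absurd rfl hn
      · rw [Function.update_of_ne h] at hl
        exact ⟨t', l, by rw [Function.update_of_ne h, hl], rfl⟩

end Level

end BraidThree

/-! ### Artin's relation as a third Reidemeister move -/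

namespace BraidThree

open Diagram

section HalfTwist

variable {T : Type} [DecidableEq T] (rot : Equiv.Perm T) (f : T → Option (Fin 2 × Bool)) (t : T)

/-- A closed braid diagram in which the levels `t` and `rot t` are replaced by a half twist of the
three strings, each of which has two marked points `(t, j)` and `(rot t, j)` there. The crossings
of the half twist are those in `C`. -/
def halfTwist (C : Set (Crossing (T × Fin 3))) (hC : ∀ c ∈ C, c.left ≠ c.right)
    (hCC : ∀ c ∈ C, ∀ d ∈ C, ∀ p, c.Meets p → d.Meets p → c = d)
    (hCt : ∀ c ∈ C, ∀ p, c.Meets p → p.1 = t ∨ p.1 = rot t) : Diagram (T × Fin 3) where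
  next := Equiv.prodShear rot fun t' =>
    if t' = t then 1 else if t' = rot t then Equiv.swap 0 2 else levelPerm (f t')
  crossings := {c | c ∈ (level rot f).crossings ∧ c.left.1 ≠ t ∧ c.left.1 ≠ rot t} ∪ C
  left_ne_right := by
    rintro c (⟨hc, -⟩ | hc)
    · exact (level rot f).left_ne_right c hc
    · exact hC c hc
  eq_of_meets := by
    have key : ∀ c ∈ (level rot f).crossings, ∀ p, c.Meets p → p.1 = c.left.1 := by
      rintro _ ⟨t', l, hl, rfl⟩ p (rfl | rfl) <;> rfl
    rintro c (⟨hc, h1, h2⟩ | hc) d (⟨hd, h3, h4⟩ | hd) p hp hp'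
    · exact (level rot f).eq_of_meets c hc d hd p hp hp'
    · rw [← key c hc p hp] at h1 h2
      exact absurd (hCt d hd p hp') (by tauto)
    · rw [← key d hd p hp'] at h3 h4
      exact absurd (hCt c hc p hp) (by tauto)
    · exact hCC c hc d hd p hp hp'

variable (ht : rot t ≠ t)

/-- The half twist `σ₁ σ₂ σ₁`. -/
def halfTwistLeft : Diagram (T × Fin 3) :=
  halfTwist rot f t {⟨(t, 0), (t, 1), 1⟩, ⟨(rot t, 0), (t, 2), 1⟩, ⟨(rot t, 1), (rot t, 2), 1⟩}
    (by simp)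
    (by
      rintro c (rfl | rfl | rfl) d (rfl | rfl | rfl) p (rfl | rfl) <;>
        simp [Crossing.Meets, ht, ht.symm])
    (by rintro c (rfl | rfl | rfl) p (rfl | rfl) <;> simp)

/-- The half twist `σ₂ σ₁ σ₂`. -/
def halfTwistRight : Diagram (T × Fin 3) :=
  halfTwist rot f t {⟨(rot t, 0), (rot t, 1), 1⟩, ⟨(t, 0), (rot t, 2), 1⟩, ⟨(t, 1), (t, 2), 1⟩}
    (by simp)
    (by
      rintro c (rfl | rfl | rfl) d (rfl | rfl | rfl) p (rfl | rfl) <;>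
        simp [Crossing.Meets, ht, ht.symm])
    (by rintro c (rfl | rfl | rfl) p (rfl | rfl) <;> simp)

/-- The third Reidemeister move keeps `next` and needs the two crossings on each strand to be
adjacent. This is why the half twist is drawn on two marked points per string instead of three
levels. -/
theorem move_halfTwist : (halfTwistLeft rot f t ht).Move (halfTwistRight rot f t ht) := by
  have hu : ∀ (x y : T × Fin 3), (⟨x, y, 1⟩ : Crossing (T × Fin 3)).upper = x :=
    fun x y => by simp [Crossing.upper]
  have hl : ∀ (x y : T × Fin 3), (⟨x, y, 1⟩ : Crossing (T × Fin 3)).lower = y :=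
    fun x y => by simp [Crossing.lower]
  have ho : ∀ x y : T × Fin 3, Crossing.ofUpperLower x y 1 = ⟨x, y, 1⟩ :=
    fun x y => by simp [Crossing.ofUpperLower]
  have hn : ∀ j, (halfTwistLeft rot f t ht).next (t, j) = (rot t, j) := by
    intro j
    simp [halfTwistLeft, halfTwist]
  refine Move.reidemeister3 _ _ ⟨(t, 0), (t, 1), 1⟩ ⟨(rot t, 0), (t, 2), 1⟩
    ⟨(rot t, 1), (rot t, 2), 1⟩ (by simp [halfTwistLeft, halfTwist])
    (by simp [halfTwistLeft, halfTwist]) (by simp [halfTwistLeft, halfTwist])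
    (by simp) (by simp) (by simp) 1 1 1 (Or.inl ⟨rfl, ?_⟩) (Or.inl ⟨rfl, ?_⟩)
    (Or.inl ⟨rfl, ?_⟩) rfl rfl rfl ?_
  · rw [hu, hu, hn]
  · rw [hu, hl, hn]
  · rw [hl, hl, hn]
  · simp only [hu, hl, ho]
    change _ ∪ _ = (_ ∪ _) \ _ ∪ _
    rw [Set.union_sdiff_right]
    congr 1
    symm
    rw [sdiff_eq_left, Set.disjoint_left]
    rintro c ⟨-, h1, h2⟩ (rfl | rfl | rfl)
    · exact h1 rfl
    · exact h2 rfl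
    · exact h2 rfl

/-- The letters of a closed braid with one more level before `rot t`, and with the letters `i`, `j`,
`i` at the level `t`, the new level, and the level `rot t`. -/
def threeLetters (i j : Fin 2) : Option T → Option (Fin 2 × Bool)
  | none => some (j, true)
  | some x => if x = t ∨ x = rot t then some (i, true) else f x

/-- The names of the points of the half twist `σ₁ σ₂ σ₁` on three levels. -/
def leftEquiv : Option (Option (Option (T × Fin 3))) ≃ Option T × Fin 3 where
  toFun
    | none => (some t, 2)
    | some none => (none, 0)
    | some (some none) => (some (rot t), 2)
    | some (some (some (t', j))) =>
      if t' = t then ![(some t, 0), (some t, 1), (none, 2)] j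
      else if t' = rot t then ![(none, 1), (some (rot t), 0), (some (rot t), 1)] j
      else (some t', j)
  invFun
    | (none, j) => ![some none, some (some (some (rot t, 0))), some (some (some (t, 2)))] j
    | (some t', j) =>
      if t' = t then ![some (some (some (t, 0))), some (some (some (t, 1))), none] j
      else if t' = rot t then
        ![some (some (some (rot t, 1))), some (some (some (rot t, 2))), some (some none)] j
      else some (some (some (t', j)))
  left_inv := by
    rintro (_ | _ | _ | ⟨t', j⟩)
    · simp
    · simp
    · simp [ht]
    · by_cases h : t' = t
      · subst h; fin_cases j <;> simp
      · by_cases h2 : t' = rot t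
        · subst h2; fin_cases j <;> simp [ht]
        · simp [h, h2]
  right_inv := by
    rintro ⟨_ | t', j⟩
    · fin_cases j <;> simp [ht]
    · by_cases h : t' = t
      · subst h; fin_cases j <;> simp
      · by_cases h2 : t' = rot t
        · subst h2; fin_cases j <;> simp [ht]
        · simp [h, h2]

/-- The names of the points of the half twist `σ₂ σ₁ σ₂` on three levels. -/
def rightEquiv : Option (Option (Option (T × Fin 3))) ≃ Option T × Fin 3 where
  toFun
    | none => (some t, 0)
    | some none => (none, 2)
    | some (some none) => (some (rot t), 0)
    | some (some (some (t', j))) =>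
      if t' = t then ![(none, 0), (some t, 1), (some t, 2)] j
      else if t' = rot t then ![(some (rot t), 1), (some (rot t), 2), (none, 1)] j
      else (some t', j)
  invFun
    | (none, j) => ![some (some (some (t, 0))), some (some (some (rot t, 2))), some none] j
    | (some t', j) =>
      if t' = t then ![none, some (some (some (t, 1))), some (some (some (t, 2)))] j
      else if t' = rot t then
        ![some (some none), some (some (some (rot t, 0))), some (some (some (rot t, 1)))] j
      else some (some (some (t', j)))
  left_inv := by
    rintro (_ | _ | _ | ⟨t', j⟩)
    · simp
    · simp
    · simp [ht]
    · by_cases h : t' = t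
      · subst h; fin_cases j <;> simp
      · by_cases h2 : t' = rot t
        · subst h2; fin_cases j <;> simp [ht]
        · simp [h, h2]
  right_inv := by
    rintro ⟨_ | t', j⟩
    · fin_cases j <;> simp [ht]
    · by_cases h : t' = t
      · subst h; fin_cases j <;> simp
      · by_cases h2 : t' = rot t
        · subst h2; fin_cases j <;> simp [ht]
        · simp [h, h2]

/-- On each of the three levels one string passes beside the crossing. The three added marks are
these passing points: on string `2` before its crossings, on string `1` between them, on string `0`
after them. -/
theorem relabel_halfTwistLeft :
    ((((halfTwistLeft rot f t ht).markBefore (rot (rot t), 2)).markBefore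
      (some (rot t, 1))).markBefore (some (some (t, 2)))).relabel (leftEquiv rot t ht) =
      level (insertBefore rot (rot t)) (threeLetters rot f t 0 1) := by
  have hrr : rot (rot t) ≠ rot t := fun h => ht (rot.injective h)
  have p0 : levelPerm (some (0, true)) = Equiv.swap 0 1 := rfl
  have p1 : levelPerm (some (1, true)) = Equiv.swap 1 2 := rfl
  have s1 : Equiv.swap (0 : Fin 3) 2 1 = 1 := by decide
  refine relabel_eq _ ?_ ?_
  · rintro (_ | _ | _ | ⟨t', j⟩)
    · simp [leftEquiv, markBefore, insertBefore_some, threeLetters, p0]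
      decide
    · simp [leftEquiv, markBefore, insertBefore_some, threeLetters, p1, ht]
      decide
    -- With only two old levels, the level above the half twist is again the level `t`, and two of
    -- the added marks lie on the same arc.
    · by_cases h : rot (rot t) = t
      · simp [leftEquiv, markBefore, insertBefore_some, threeLetters, p0, ht, h, ht.symm]
        decide
      · simp [leftEquiv, markBefore, insertBefore_some, threeLetters, p0, ht, h, hrr]
        decide
    · by_cases h1 : t' = t
      · subst h1
        fin_cases j <;>
          simp [leftEquiv, markBefore, insertBefore_some, threeLetters, p0, p1, halfTwistLeft, halfTwist, ht,
            hrr.symm]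
      by_cases h2 : t' = rot t
      · subst h2
        by_cases h : rot (rot t) = t
        · fin_cases j <;>
            simp [leftEquiv, markBefore, insertBefore_some, threeLetters, p0, p1, halfTwistLeft, halfTwist,
              ht, h, ht.symm, s1]
        · fin_cases j <;>
            simp [leftEquiv, markBefore, insertBefore_some, threeLetters, p0, p1, halfTwistLeft, halfTwist,
              ht, h, hrr, s1]
      have h3 : rot t' ≠ rot t := fun h => h1 (rot.injective h)
      have h4 : rot t' ≠ rot (rot t) := fun h => h2 (rot.injective h)
      obtain ⟨k, hk⟩ : ∃ k, levelPerm (f t') j = k := ⟨_, rfl⟩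
      by_cases h : rot t' = t
      · fin_cases k <;>
          simp_all [leftEquiv, markBefore, insertBefore_some, threeLetters, halfTwistLeft, halfTwist]
      · simp [leftEquiv, markBefore, insertBefore_some, threeLetters, halfTwistLeft, halfTwist,
          h1, h2, h3, h4, h, hk]
  · have hlevel : ∀ t' l, t' ≠ t → t' ≠ rot t →
        Crossing.map (leftEquiv rot t ht) (((levelCrossing t' l).map some).map some |>.map some) =
          levelCrossing (some t') l := by
      intro t' l h1 h2
      simp [leftEquiv, Crossing.map, levelCrossing, h1, h2]
    ext c
    constructor
    · rintro ⟨_ | t', l, hl, rfl⟩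
      · cases hl
        refine ⟨_, ⟨_, ⟨_, ⟨⟨(rot t, 0), (t, 2), 1⟩, Or.inr (by simp), rfl⟩, rfl⟩, rfl⟩, ?_⟩
        simp [leftEquiv, Crossing.map, levelCrossing, ht]
      · by_cases h1 : t' = t
        · subst h1
          simp only [threeLetters, true_or, if_true] at hl
          cases hl
          refine ⟨_, ⟨_, ⟨_, ⟨⟨(t', 0), (t', 1), 1⟩, Or.inr (by simp), rfl⟩, rfl⟩, rfl⟩, ?_⟩
          simp [leftEquiv, Crossing.map, levelCrossing]
        by_cases h2 : t' = rot t
        · subst h2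
          simp only [threeLetters, or_true, if_true] at hl
          cases hl
          refine ⟨_, ⟨_, ⟨_, ⟨⟨(rot t, 1), (rot t, 2), 1⟩, Or.inr (by simp), rfl⟩, rfl⟩, rfl⟩, ?_⟩
          simp [leftEquiv, Crossing.map, levelCrossing, ht]
        · rw [threeLetters, if_neg (by tauto)] at hl
          exact ⟨_, ⟨_, ⟨_, ⟨_, Or.inl ⟨⟨t', l, hl, rfl⟩, h1, h2⟩, rfl⟩, rfl⟩, rfl⟩,
            hlevel t' l h1 h2⟩
    · rintro ⟨_, ⟨_, ⟨_, ⟨_, (⟨⟨t', l, hl, rfl⟩, h1, h2⟩ | h), rfl⟩, rfl⟩, rfl⟩, rfl⟩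
      · refine ⟨some t', l, ?_, hlevel t' l h1 h2⟩
        change t' ≠ t at h1
        change t' ≠ rot t at h2
        rw [threeLetters, if_neg (by tauto), hl]
      · rcases h with rfl | rfl | rfl
        · refine ⟨some t, (0, true), by simp [threeLetters], ?_⟩
          simp [leftEquiv, Crossing.map, levelCrossing]
        · refine ⟨none, (1, true), by simp [threeLetters], ?_⟩
          simp [leftEquiv, Crossing.map, levelCrossing, ht]
        · refine ⟨some (rot t), (0, true), by simp [threeLetters], ?_⟩
          simp [leftEquiv, Crossing.map, levelCrossing, ht]

theorem relabel_halfTwistRight :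
    ((((halfTwistRight rot f t ht).markBefore (rot (rot t), 0)).markBefore
      (some (rot t, 1))).markBefore (some (some (t, 0)))).relabel (rightEquiv rot t ht) =
      level (insertBefore rot (rot t)) (threeLetters rot f t 1 0) := by
  have hrr : rot (rot t) ≠ rot t := fun h => ht (rot.injective h)
  have p0 : levelPerm (some (0, true)) = Equiv.swap 0 1 := rfl
  have p1 : levelPerm (some (1, true)) = Equiv.swap 1 2 := rfl
  have s1 : Equiv.swap (0 : Fin 3) 2 1 = 1 := by decide
  refine relabel_eq _ ?_ ?_
  · rintro (_ | _ | _ | ⟨t', j⟩)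
    · simp [rightEquiv, markBefore, insertBefore_some, threeLetters, p1]
      decide
    · simp [rightEquiv, markBefore, insertBefore_some, threeLetters, p0, ht]
      decide
    · by_cases h : rot (rot t) = t
      · simp [rightEquiv, markBefore, insertBefore_some, threeLetters, p1, ht, h, ht.symm]
        decide
      · simp [rightEquiv, markBefore, insertBefore_some, threeLetters, p1, ht, h, hrr]
        decide
    · by_cases h1 : t' = t
      · subst h1
        fin_cases j <;>
          simp [rightEquiv, markBefore, insertBefore_some, threeLetters, p0, p1, halfTwistRight, halfTwist, ht,
            hrr.symm]
      by_cases h2 : t' = rot t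
      · subst h2
        by_cases h : rot (rot t) = t
        · fin_cases j <;>
            simp [rightEquiv, markBefore, insertBefore_some, threeLetters, p0, p1, halfTwistRight, halfTwist,
              ht, h, ht.symm, s1]
        · fin_cases j <;>
            simp [rightEquiv, markBefore, insertBefore_some, threeLetters, p0, p1, halfTwistRight, halfTwist,
              ht, h, hrr, s1]
      have h3 : rot t' ≠ rot t := fun h => h1 (rot.injective h)
      have h4 : rot t' ≠ rot (rot t) := fun h => h2 (rot.injective h)
      obtain ⟨k, hk⟩ : ∃ k, levelPerm (f t') j = k := ⟨_, rfl⟩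
      by_cases h : rot t' = t
      · fin_cases k <;>
          simp_all [rightEquiv, markBefore, insertBefore_some, threeLetters, halfTwistRight, halfTwist]
      · simp [rightEquiv, markBefore, insertBefore_some, threeLetters, halfTwistRight, halfTwist,
          h1, h2, h3, h4, h, hk]
  · have hlevel : ∀ t' l, t' ≠ t → t' ≠ rot t →
        Crossing.map (rightEquiv rot t ht) (((levelCrossing t' l).map some).map some |>.map some) =
          levelCrossing (some t') l := by
      intro t' l h1 h2
      simp [rightEquiv, Crossing.map, levelCrossing, h1, h2]
    ext c
    constructor
    · rintro ⟨_ | t', l, hl, rfl⟩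
      · cases hl
        refine ⟨_, ⟨_, ⟨_, ⟨⟨(t, 0), (rot t, 2), 1⟩, Or.inr (by simp), rfl⟩, rfl⟩, rfl⟩, ?_⟩
        simp [rightEquiv, Crossing.map, levelCrossing, ht]
      · by_cases h1 : t' = t
        · subst h1
          simp only [threeLetters, true_or, if_true] at hl
          cases hl
          refine ⟨_, ⟨_, ⟨_, ⟨⟨(t', 1), (t', 2), 1⟩, Or.inr (by simp), rfl⟩, rfl⟩, rfl⟩, ?_⟩
          simp [rightEquiv, Crossing.map, levelCrossing]
        by_cases h2 : t' = rot t
        · subst h2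
          simp only [threeLetters, or_true, if_true] at hl
          cases hl
          refine ⟨_, ⟨_, ⟨_, ⟨⟨(rot t, 0), (rot t, 1), 1⟩, Or.inr (by simp), rfl⟩, rfl⟩, rfl⟩, ?_⟩
          simp [rightEquiv, Crossing.map, levelCrossing, ht]
        · rw [threeLetters, if_neg (by tauto)] at hl
          exact ⟨_, ⟨_, ⟨_, ⟨_, Or.inl ⟨⟨t', l, hl, rfl⟩, h1, h2⟩, rfl⟩, rfl⟩, rfl⟩,
            hlevel t' l h1 h2⟩
    · rintro ⟨_, ⟨_, ⟨_, ⟨_, (⟨⟨t', l, hl, rfl⟩, h1, h2⟩ | h), rfl⟩, rfl⟩, rfl⟩, rfl⟩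
      · refine ⟨some t', l, ?_, hlevel t' l h1 h2⟩
        change t' ≠ t at h1
        change t' ≠ rot t at h2
        rw [threeLetters, if_neg (by tauto), hl]
      · rcases h with rfl | rfl | rfl
        · refine ⟨some (rot t), (1, true), by simp [threeLetters], ?_⟩
          simp [rightEquiv, Crossing.map, levelCrossing, ht]
        · refine ⟨none, (0, true), by simp [threeLetters], ?_⟩
          simp [rightEquiv, Crossing.map, levelCrossing, ht]
        · refine ⟨some t, (1, true), by simp [threeLetters], ?_⟩
          simp [rightEquiv, Crossing.map, levelCrossing]

end HalfTwist

end BraidThree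

/-! ### The invariant as a function on the braid group -/

namespace BraidThree

open Diagram

universe u

section Invariant

variable {A : Type u} {𝒜 : ConwayAlgebra A} {w : ∀ {P : Type}, Diagram P → A}

theorem apply_relabel (hw : 𝒜.IsLinkInvariant w) {P Q : Type} [Finite P] [Finite Q]
    {D : Diagram P} (hD : D.Planar) (e : P ≃ Q) : w (D.relabel e) = w D :=
  (hw.isotopy _ _ hD ((planar_relabel D e).2 hD) (move_relabel D e)).symm

theorem apply_markBefore (hw : 𝒜.IsLinkInvariant w) {P : Type} [Finite P] [DecidableEq P]
    {D : Diagram P} (hD : D.Planar) (p : P) : w (D.markBefore p) = w D :=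
  (hw.isotopy _ _ hD ((planar_markBefore D p).2 hD) (move_markBefore D p)).symm

theorem apply_markBefore_thrice (hw : 𝒜.IsLinkInvariant w) {P Q : Type} [Finite P] [Finite Q]
    [DecidableEq P] {D : Diagram P} {p : P} {q : Option P} {r : Option (Option P)}
    {e : Option (Option (Option P)) ≃ Q} {D' : Diagram Q}
    (h : (((D.markBefore p).markBefore q).markBefore r).relabel e = D') (hD : D.Planar) :
    w D' = w D := by
  have h1 := (planar_markBefore D p).2 hD
  have h2 := (planar_markBefore _ q).2 h1
  have h3 := (planar_markBefore _ r).2 h2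
  rw [← h, apply_relabel hw h3, apply_markBefore hw h2, apply_markBefore hw h1,
    apply_markBefore hw hD]

theorem planar_of_markBefore_thrice {P Q : Type} [DecidableEq P] {D : Diagram P} {p : P}
    {q : Option P} {r : Option (Option P)} {e : Option (Option (Option P)) ≃ Q} {D' : Diagram Q}
    (h : (((D.markBefore p).markBefore q).markBefore r).relabel e = D') (hD : D'.Planar) :
    D.Planar := by
  rwa [← h, planar_relabel, planar_markBefore, planar_markBefore, planar_markBefore] at hD

/-- The half twist diagrams are not level diagrams; their planarity is inherited from the closed
braids obtained from them by marking and renaming points. -/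
theorem apply_halfTwist (hw : 𝒜.IsLinkInvariant w) {T : Type} [Finite T] [DecidableEq T]
    (rot : Equiv.Perm T) (f : T → Option (Fin 2 × Bool)) (t : T) (ht : rot t ≠ t)
    (hrot : IsCyclic (insertBefore rot (rot t))) :
    w (level (insertBefore rot (rot t)) (threeLetters rot f t 0 1)) =
      w (level (insertBefore rot (rot t)) (threeLetters rot f t 1 0)) := by
  have hl := relabel_halfTwistLeft rot f t ht
  have hr := relabel_halfTwistRight rot f t ht
  have pl := planar_of_markBefore_thrice hl (planar_level hrot)
  have pr := planar_of_markBefore_thrice hr (planar_level hrot)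
  rw [apply_markBefore_thrice hw hl pl, apply_markBefore_thrice hw hr pr]
  exact hw.isotopy _ _ pl pr (move_halfTwist rot f t ht)

variable (w) in
/-- The value on the closed braid diagram with `n` levels and the letter `F i` at level `i`. -/
def levelValue (n : ℕ) (F : ℕ → Option (Fin 2 × Bool)) : A :=
  w (level (finRotate n) fun t : Fin n => F t)

theorem levelValue_congr {n m : ℕ} (h : n = m) {F G : ℕ → Option (Fin 2 × Bool)}
    (hFG : ∀ i < n, F i = G i) : levelValue w n F = levelValue w m G := by
  subst h
  have : (fun t : Fin n => F t) = fun t : Fin n => G t := funext fun t => hFG t t.2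
  rw [levelValue, levelValue, this]

theorem planar_level_fin (n : ℕ) (f : Fin (n + 1) → Option (Fin 2 × Bool)) :
    (level (finRotate (n + 1)) f).Planar :=
  planar_level (isCyclic_finRotate _)

theorem finRotate_val (n : ℕ) (t : Fin (n + 1)) :
    (finRotate (n + 1) t : ℕ) = if (t : ℕ) = n then 0 else (t : ℕ) + 1 := by
  rw [coe_finRotate]
  simp [Fin.ext_iff]

theorem levelValue_rotate (hw : 𝒜.IsLinkInvariant w) (n : ℕ) (F : ℕ → Option (Fin 2 × Bool)) :
    levelValue w (n + 1) F =
      levelValue w (n + 1) fun i => if i = n then F 0 else F (i + 1) := by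
  have h := relabel_level (rot := finRotate (n + 1)) (rot' := finRotate (n + 1))
    (f := fun t : Fin (n + 1) => F t) (f' := fun t : Fin (n + 1) => F (finRotate (n + 1) t))
    (finRotate (n + 1)).symm (by simp) (by simp)
  have h2 := apply_relabel hw (planar_level_fin n fun t => F t)
    ((finRotate (n + 1)).symm.prodCongr (Equiv.refl (Fin 3)))
  rw [h] at h2
  rw [levelValue, levelValue, ← h2]
  congr 2
  ext1 t
  rw [finRotate_val]
  split_ifs <;> rfl

theorem finRotate_insertBefore (n : ℕ) (o : Option (Fin (n + 1))) :
    finRotate (n + 2) (finSuccEquivLast.symm o) =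
      finSuccEquivLast.symm (insertBefore (finRotate (n + 1)) 0 o) := by
  rcases o with _ | t
  · simp
  · rw [insertBefore_some]
    apply Fin.ext
    rw [finRotate_val]
    have h1 := finRotate_val n t
    have h2 := t.2
    split_ifs with h3 h4 h5
    · simp at h3; omega
    · simp at h3; omega
    · rw [h5] at h1
      simp only [finSuccEquivLast_symm_some, finSuccEquivLast_symm_none, Fin.val_castSucc,
        Fin.val_last]
      simp only [Fin.val_zero] at h1
      split_ifs at h1 with h6
      omega
    · simp only [finSuccEquivLast_symm_some, Fin.val_castSucc]
      rw [h1, if_neg]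
      intro h6
      rw [if_pos h6] at h1
      exact h5 (Fin.ext h1)

theorem isCyclic_insertBefore (n : ℕ) : IsCyclic (insertBefore (finRotate (n + 1)) 0) := by
  refine IsCyclic.of_equiv finSuccEquivLast ?_ (isCyclic_finRotate (n + 2))
  intro t
  have := finRotate_insertBefore n (finSuccEquivLast t)
  rw [Equiv.symm_apply_apply] at this
  rw [this, Equiv.apply_symm_apply]

/-- Numbering the levels when the inserted one is put last. -/
theorem apply_level_insertBefore (hw : 𝒜.IsLinkInvariant w) (n : ℕ)
    (f : Option (Fin (n + 1)) → Option (Fin 2 × Bool)) (G : ℕ → Option (Fin 2 × Bool))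
    (hnone : G (n + 1) = f none) (hsome : ∀ t : Fin (n + 1), G t = f (some t)) :
    w (level (insertBefore (finRotate (n + 1)) 0) f) = levelValue w (n + 2) G := by
  have h := relabel_level (rot := insertBefore (finRotate (n + 1)) 0) (rot' := finRotate (n + 2))
    (f := f) (f' := fun t : Fin (n + 2) => G t) finSuccEquivLast.symm
    (finRotate_insertBefore n) (by
      rintro (_ | t)
      · simpa using hnone
      · simpa using hsome t)
  rw [levelValue, ← h, apply_relabel hw (planar_level (isCyclic_insertBefore n))]

theorem levelValue_insert (hw : 𝒜.IsLinkInvariant w) (n : ℕ) (F : ℕ → Option (Fin 2 × Bool)) :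
    levelValue w (n + 2) (fun i => if i = n + 1 then none else F i) = levelValue w (n + 1) F := by
  have h := insert_level (rot := finRotate (n + 1)) (f := fun t : Fin (n + 1) => F t) 0
  change _ = w (level (finRotate (n + 1)) fun t : Fin (n + 1) => F t)
  rw [← apply_markBefore_thrice hw h (planar_level_fin n _),
    apply_level_insertBefore hw n _ (fun i => if i = n + 1 then none else F i)]
  · simp
  · intro t
    have := t.2
    rw [if_neg (by omega)]
    rfl

theorem levelValue_cancel (hw : 𝒜.IsLinkInvariant w) (n : ℕ) {F : ℕ → Option (Fin 2 × Bool)}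
    {i : Fin 2} {b : Bool} (h0 : F 0 = some (i, b)) (h1 : F 1 = some (i, !b)) :
    levelValue w (n + 2) F = levelValue w (n + 2) fun i => if i < 2 then none else F i := by
  have hr : finRotate (n + 2) 0 = 1 := by simp
  have hm := move_cancel (rot := finRotate (n + 2)) (f := fun t : Fin (n + 2) => F t) (t := 0)
    (i := i) (b := b) (by rw [hr]; simp) (by simpa using h0) (by rw [hr]; simpa using h1)
  have hp := planar_level_fin (n + 1) (Function.update (Function.update
    (fun t : Fin (n + 2) => F t) 0 none) (finRotate (n + 2) 0) none)
  rw [levelValue, hw.isotopy _ _ (planar_level_fin _ _) ((planar_relabel _ _).2 hp) hm,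
    apply_relabel hw hp, levelValue]
  congr 2
  ext1 t
  rw [hr]
  by_cases ht1 : t = 1
  · subst ht1; simp
  by_cases ht0 : t = 0
  · subst ht0; simp
  have : ¬ (t : ℕ) < 2 := by
    simp only [Fin.ext_iff, Fin.val_one, Fin.val_zero] at ht0 ht1
    omega
  simp [ht0, ht1, this]

/-- The inserted level gets the last number `m + 2`, so the three letters occupy the cyclically
consecutive levels `m + 1`, `m + 2`, `0`. -/
theorem levelValue_braid (hw : 𝒜.IsLinkInvariant w) (m : ℕ) (F : ℕ → Option (Fin 2 × Bool)) :
    levelValue w (m + 3) (fun k => if k = m + 2 then some (1, true) else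
      if k = m + 1 ∨ k = 0 then some (0, true) else F k) =
    levelValue w (m + 3) (fun k => if k = m + 2 then some (0, true) else
      if k = m + 1 ∨ k = 0 then some (1, true) else F k) := by
  have hr : finRotate (m + 2) (Fin.last (m + 1)) = 0 := finRotate_last
  have h := apply_halfTwist hw (finRotate (m + 2)) (fun t : Fin (m + 2) => F t)
    (Fin.last (m + 1)) (by rw [hr]; exact (Fin.last_pos).ne) (by
      rw [hr]; exact isCyclic_insertBefore (m + 1))
  rw [hr] at h
  have key : ∀ i j : Fin 2,
      w (level (insertBefore (finRotate (m + 2)) 0)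
        (threeLetters (finRotate (m + 2)) (fun t : Fin (m + 2) => F t) (Fin.last (m + 1)) i j)) =
      levelValue w (m + 3) (fun k => if k = m + 2 then some (j, true) else
        if k = m + 1 ∨ k = 0 then some (i, true) else F k) := by
    intro i j
    refine apply_level_insertBefore hw (m + 1) _ _ ?_ ?_
    · simp [threeLetters]
    · intro t
      have := t.2
      rw [if_neg (by omega), threeLetters, hr]
      simp only [Fin.ext_iff, Fin.val_last, Fin.val_zero]
  rw [key, key] at h
  exact h

theorem levelValue_skein (hw : 𝒜.IsLinkInvariant w) (n : ℕ) (F : ℕ → Option (Fin 2 × Bool))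
    (i : Fin 2) :
    levelValue w (n + 1) (Function.update F 0 (some (i, true))) =
      𝒜.bar (levelValue w (n + 1) (Function.update F 0 (some (i, false))))
        (levelValue w (n + 1) (Function.update F 0 none)) := by
  have key : ∀ o, (fun t : Fin (n + 1) => Function.update F 0 o t) =
      Function.update (fun t : Fin (n + 1) => F t) 0 o := by
    intro o
    ext1 t
    by_cases h : t = 0
    · subst h; simp
    · have h' : (t : ℕ) ≠ 0 := fun e => h (Fin.ext e)
      rw [Function.update_of_ne h, Function.update_of_ne h']
  simp only [levelValue, key]
  exact hw.conway_pos _ _ _ (planar_level_fin _ _) (planar_level_fin _ _) (planar_level_fin _ _)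
    (skeinTriple_level 0 i)

variable (w) in
/-- The value on the closed braid diagram whose levels are given by a list. -/
def listValue (ℓ : List (Option (Fin 2 × Bool))) : A :=
  levelValue w ℓ.length fun i => ℓ[i]?.join

theorem listValue_rotate (hw : 𝒜.IsLinkInvariant w) (a : Option (Fin 2 × Bool))
    (ℓ : List (Option (Fin 2 × Bool))) : listValue w (a :: ℓ) = listValue w (ℓ ++ [a]) := by
  rw [listValue, List.length_cons, levelValue_rotate hw]
  refine levelValue_congr (by simp) fun i hi => ?_
  split_ifs with h
  · subst h; simp
  · rw [List.getElem?_append_left (by omega)]; simp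

theorem listValue_append_comm (hw : 𝒜.IsLinkInvariant w) (ℓ ℓ' : List (Option (Fin 2 × Bool))) :
    listValue w (ℓ ++ ℓ') = listValue w (ℓ' ++ ℓ) := by
  induction ℓ generalizing ℓ' with
  | nil => simp
  | cons a ℓ ih =>
    rw [List.cons_append, listValue_rotate hw, List.append_assoc, ih]
    simp

/-- An empty level is made by marking points on existing arcs, so at least one other level is
required. -/
theorem listValue_none_cons (hw : 𝒜.IsLinkInvariant w) {ℓ : List (Option (Fin 2 × Bool))}
    (hℓ : ℓ ≠ []) : listValue w (none :: ℓ) = listValue w ℓ := by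
  obtain ⟨n, hn⟩ := Nat.exists_eq_succ_of_ne_zero (List.length_pos_iff.2 hℓ).ne'
  rw [listValue_rotate hw]
  have h := levelValue_insert hw n fun i => ℓ[i]?.join
  rw [listValue, listValue]
  refine Eq.trans (levelValue_congr (by simp [hn]) fun i hi => ?_)
    (h.trans (levelValue_congr hn.symm fun _ _ => rfl))
  split_ifs with h'
  · subst h'; simp [hn]
  · rw [List.getElem?_append_left]
    simp only [List.length_append, List.length_singleton] at hi
    omega

theorem listValue_cancel (hw : 𝒜.IsLinkInvariant w) (i : Fin 2) (b : Bool)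
    {ℓ : List (Option (Fin 2 × Bool))} (hℓ : ℓ ≠ []) :
    listValue w (some (i, b) :: some (i, !b) :: ℓ) = listValue w ℓ := by
  rw [← listValue_none_cons hw hℓ, ← listValue_none_cons hw (ℓ := none :: ℓ) (List.cons_ne_nil _ _),
    listValue, List.length_cons, List.length_cons, levelValue_cancel hw ℓ.length (i := i) (b := b)
    (by simp) (by simp)]
  refine levelValue_congr rfl fun k _ => ?_
  rcases k with _ | _ | k <;> simp

theorem listValue_braid (hw : 𝒜.IsLinkInvariant w) (ℓ : List (Option (Fin 2 × Bool))) :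
    listValue w (some (0, true) :: some (1, true) :: some (0, true) :: ℓ) =
      listValue w (some (1, true) :: some (0, true) :: some (1, true) :: ℓ) := by
  have key : ∀ i j : Fin 2,
      listValue w (some (i, true) :: some (j, true) :: some (i, true) :: ℓ) =
      levelValue w (ℓ.length + 3) (fun k => if k = ℓ.length + 2 then some (j, true) else
        if k = ℓ.length + 1 ∨ k = 0 then some (i, true) else ℓ[k - 1]?.join) := by
    intro i j
    -- Move the first two letters to the end; the third then stands at level `0`, as in
    -- `levelValue_braid`.
    have h := listValue_append_comm hw [some (i, true), some (j, true)] (some (i, true) :: ℓ)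
    rw [List.cons_append, List.cons_append, List.nil_append] at h
    rw [h, listValue]
    refine levelValue_congr (by simp) fun k hk => ?_
    simp only [List.length_append, List.length_cons, List.length_nil] at hk
    split_ifs with h1 h2
    · subst h1
      rw [List.getElem?_append_right (by simp)]
      simp
    · rcases h2 with rfl | rfl
      · rw [List.getElem?_append_right (by simp)]
        simp
      · simp
    · rw [List.getElem?_append_left (by simp; omega)]
      obtain ⟨k, rfl⟩ := Nat.exists_eq_succ_of_ne_zero (fun h => h2 (Or.inr h))
      simp
  rw [key, key, levelValue_braid hw]

theorem listValue_skein (hw : 𝒜.IsLinkInvariant w) (i : Fin 2)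
    (ℓ : List (Option (Fin 2 × Bool))) :
    listValue w (some (i, true) :: ℓ) =
      𝒜.bar (listValue w (some (i, false) :: ℓ)) (listValue w (none :: ℓ)) := by
  have key : ∀ o : Option (Fin 2 × Bool), listValue w (o :: ℓ) = levelValue w (ℓ.length + 1)
      (Function.update (fun k => ℓ[k - 1]?.join) 0 o) := by
    intro o
    refine levelValue_congr rfl fun k _ => ?_
    rcases k with _ | k <;> simp
  rw [key, key, key, levelValue_skein hw]

variable (w) in
theorem apply_closure_eq (u : Word) :
    w u.closure = listValue w (u.map some ++ [none]) := by
  rw [closure_eq_level]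
  refine levelValue_congr (F := fun i => u[i]?) (by simp) fun i hi => ?_
  by_cases h : i < u.length
  · rw [List.getElem?_append_left (by simpa using h), List.getElem?_map]
    cases u[i]? <;> rfl
  · obtain rfl : i = u.length := by omega
    simp

theorem apply_closure_append_comm (hw : 𝒜.IsLinkInvariant w) (u v : Word) :
    w (Word.closure (u ++ v)) = w (Word.closure (v ++ u)) := by
  -- The closure has a single empty level after the whole word. A second one is inserted so that
  -- each factor has its own and a rotation exchanges them.
  have key : ∀ u v : Word, w (Word.closure (u ++ v)) =
      listValue w (none :: u.map some ++ none :: v.map some) := by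
    intro u v
    rw [apply_closure_eq w, List.map_append, listValue_append_comm hw _ [none], List.cons_append,
      List.nil_append, ← List.cons_append, listValue_append_comm hw,
      ← listValue_none_cons hw (by simp), ← List.cons_append, listValue_append_comm hw]
  rw [key, key, listValue_append_comm hw]

theorem apply_closure_cons_cons (hw : 𝒜.IsLinkInvariant w) (i : Fin 2) (b : Bool) (u : Word) :
    w (Word.closure ((i, b) :: (i, !b) :: u)) = w u.closure := by
  rw [apply_closure_eq w, apply_closure_eq w]
  exact listValue_cancel hw i b (by simp)

theorem apply_closure_braid (hw : 𝒜.IsLinkInvariant w) (u : Word) :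
    w (Word.closure ((0, true) :: (1, true) :: (0, true) :: u)) =
      w (Word.closure ((1, true) :: (0, true) :: (1, true) :: u)) := by
  rw [apply_closure_eq w, apply_closure_eq w]
  exact listValue_braid hw _

theorem apply_closure_skein (hw : 𝒜.IsLinkInvariant w) (i : Fin 2) (u : Word) :
    w (Word.closure ((i, true) :: u)) =
      𝒜.bar (w (Word.closure ((i, false) :: u))) (w u.closure) := by
  rw [apply_closure_eq w, apply_closure_eq w, apply_closure_eq w,
    ← listValue_none_cons hw (ℓ := u.map some ++ [none]) (by simp)]
  exact listValue_skein hw i _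

/-- The invariant of closed braids as a function on the free group. -/
def freeValue (hw : 𝒜.IsLinkInvariant w) : FreeGroup (Fin 2) → A :=
  Quot.lift (fun u : Word => w u.closure) (by
    intro u v h
    cases h with
    | @not L₁ L₂ x b =>
      rw [apply_closure_append_comm hw, apply_closure_append_comm hw L₁ L₂]
      exact apply_closure_cons_cons hw x b (L₂ ++ L₁))

theorem freeValue_mul_comm (hw : 𝒜.IsLinkInvariant w) (x y : FreeGroup (Fin 2)) :
    freeValue hw (x * y) = freeValue hw (y * x) := by
  rw [← FreeGroup.mk_toWord (x := x), ← FreeGroup.mk_toWord (x := y), FreeGroup.mul_mk,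
    FreeGroup.mul_mk]
  exact apply_closure_append_comm hw _ _

/-- The elements that can be dropped as right factors form a subgroup, which is normal because
`freeValue` is cyclic. It contains Artin's relator, hence its normal closure. -/
theorem freeValue_mul_of_mem (hw : 𝒜.IsLinkInvariant w) {n : FreeGroup (Fin 2)}
    (hn : n ∈ Subgroup.normalClosure braidThreeRels) (x : FreeGroup (Fin 2)) :
    freeValue hw (x * n) = freeValue hw x := by
  have hbraid : ∀ y, freeValue hw (FreeGroup.of 0 * FreeGroup.of 1 * FreeGroup.of 0 * y) =
      freeValue hw (FreeGroup.of 1 * FreeGroup.of 0 * FreeGroup.of 1 * y) := by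
    intro y
    rw [← FreeGroup.mk_toWord (x := y)]
    exact apply_closure_braid hw _
  let S : Subgroup (FreeGroup (Fin 2)) :=
    { carrier := {n | ∀ x, freeValue hw (x * n) = freeValue hw x}
      mul_mem' := fun {a b} ha hb x => by rw [← mul_assoc, hb, ha]
      one_mem' := fun x => by rw [mul_one]
      inv_mem' := fun {a} ha x => by rw [← ha (x * a⁻¹), inv_mul_cancel_right] }
  have hS : S.Normal := ⟨fun n hn g x => by
    rw [← mul_assoc, ← mul_assoc, freeValue_mul_comm, ← mul_assoc, ← mul_assoc, hn,
      freeValue_mul_comm, mul_inv_cancel_left]⟩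
  refine Subgroup.normalClosure_le_normal (N := S) ?_ hn x
  rintro _ rfl x
  rw [freeValue_mul_comm, mul_assoc, hbraid, mul_inv_cancel_left]

theorem freeValue_eq_of_mk_eq (hw : 𝒜.IsLinkInvariant w) {x y : FreeGroup (Fin 2)}
    (h : PresentedGroup.mk braidThreeRels x = PresentedGroup.mk braidThreeRels y) :
    freeValue hw x = freeValue hw y := by
  have hm : x⁻¹ * y ∈ Subgroup.normalClosure braidThreeRels := QuotientGroup.eq.1 h
  rw [← freeValue_mul_of_mem hw hm x, mul_inv_cancel_left]

/-- The invariant of closed braids as a function on the braid group. -/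
noncomputable def braidValue (hw : 𝒜.IsLinkInvariant w) (z : BraidThree) : A :=
  freeValue hw (PresentedGroup.mk_surjective braidThreeRels z).choose

theorem braidValue_mk (hw : 𝒜.IsLinkInvariant w) (x : FreeGroup (Fin 2)) :
    braidValue hw (PresentedGroup.mk braidThreeRels x) = freeValue hw x :=
  freeValue_eq_of_mk_eq hw (PresentedGroup.mk_surjective braidThreeRels _).choose_spec

theorem braidValue_toBraid (hw : 𝒜.IsLinkInvariant w) (u : Word) :
    braidValue hw u.toBraid = w u.closure :=
  braidValue_mk hw _

theorem braidValue_mul_comm (hw : 𝒜.IsLinkInvariant w) (x y : BraidThree) :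
    braidValue hw (x * y) = braidValue hw (y * x) := by
  obtain ⟨x, rfl⟩ := PresentedGroup.mk_surjective braidThreeRels x
  obtain ⟨y, rfl⟩ := PresentedGroup.mk_surjective braidThreeRels y
  rw [← map_mul, ← map_mul, braidValue_mk, braidValue_mk, freeValue_mul_comm]

theorem braidValue_skein (hw : 𝒜.IsLinkInvariant w) (i : Fin 2) (x : BraidThree) :
    braidValue hw (sigma i * x) =
      𝒜.bar (braidValue hw ((sigma i)⁻¹ * x)) (braidValue hw x) := by
  obtain ⟨x, rfl⟩ := PresentedGroup.mk_surjective braidThreeRels x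
  change braidValue hw (PresentedGroup.mk _ (FreeGroup.of i) * _) =
    𝒜.bar (braidValue hw ((PresentedGroup.mk _ (FreeGroup.of i))⁻¹ * _)) _
  rw [← map_inv, ← map_mul, ← map_mul, braidValue_mk, braidValue_mk, braidValue_mk,
    ← FreeGroup.mk_toWord (x := x)]
  exact apply_closure_skein hw i _

end Invariant

theorem expo_prod_ofFn {n : ℕ} (g : Fin n → Fin 2) (a : Fin n → ℤ) :
    expo (List.ofFn fun i => sigma (g i) ^ a i).prod = ∑ i, a i := by
  have h : ∀ l : List BraidThree, expo l.prod = (l.map expo).sum := by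
    intro l
    induction l with
    | nil => simp
    | cons x l ih => simp [ih]
  rw [h, List.map_ofFn, List.sum_ofFn]
  simp

end BraidThree

theorem theorem3p34 {A : Type*} (𝒜 : ConwayAlgebra A)
    (w : ∀ {P : Type}, Diagram P → A) (hw : 𝒜.IsLinkInvariant w)
    (k : ℕ) (a : Fin (2 * k) → ℤ) (r : ℤ) (γ : BraidThree)
    (hγ : γ = (List.ofFn fun i : Fin (2 * k) =>
      BraidThree.sigma (if (i : ℕ) % 2 = 0 then 0 else 1) ^ a i).prod)
    (he : ∑ i, a i = 6 * r)
    (u v : BraidThree.Word) (hu : u.toBraid = γ)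
    (hv : v.toBraid = BraidThree.Delta ^ (4 * r) * γ⁻¹) :
    w u.closure = w v.closure := by
  -- The product form of `γ` matters only through its exponent sum.
  have hexp : γ.expo = 6 * r := by rw [hγ, BraidThree.expo_prod_ofFn, he]
  rw [← BraidThree.braidValue_toBraid hw, ← BraidThree.braidValue_toBraid hw, hu, hv]
  exact BraidThree.eq_dual_of_expo_eq 𝒜 (BraidThree.braidValue_mul_comm hw)
    (BraidThree.braidValue_skein hw) hexp
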